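/- Let $\mathbb K=\mathbb R$ or $\mathbb C$ and let $\mathfrak g$ be a finite-dimensional solvable Lie algebra over $\mathbb K$ with $\dim_{\mathbb K}\mathfrak g\le 6$. An \emph{ad-invariant metric} on $\mathfrak g$ is a symmetric nondegenerate $\mathbb K$-bilinear form $g$ with $g([X,Y],Z)=-g(Y,[X,Z])$ for all $X,Y,Z$. Let $\mathfrak g$ act on $\mathfrak g^*$ by $[X,\alpha]=-\alpha\circ\mathrm{ad}_X$. Then: (1) $\mathfrak g$ is $T^*$-solitary: for every linear map $\phi\colon\mathfrak g\to\mathfrak g^*$ that is symmetric ($\phi(X)(Y)=\phi(Y)(X)$) and ad-invariant ($\phi([X,Y])=[X,\phi(Y)]$) there is a derivation $D\colon\mathfrak g\to\mathfrak g^*$, i.e. a linear map with $D[X,Y]=[X,DY]-[Y,DX]$, such that $\phi=D+{}^tD$, where ${}^tD(X)(Y)=D(Y)(X)$. (2) Every ad-invariant metric $g$ on $\mathfrak g$ is solitary: every $g$-self-adjoint linear map $\phi\colon\mathfrak g\to\mathfrak g$ with $\phi([X,Y])=[X,\phi(Y)]$ for all $X,Y$ has the form $\phi=D+D^{*}$ for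 some derivation $D$ of $\mathfrak g$, with $D^{*}$ the $g$-adjoint of $D$. (3) Consequently, every ad-invariant metric $g$ on $\mathfrak g$ is unique in the following sense. (i) If $\mathbb K=\mathbb C$, every ad-invariant metric on $\mathfrak g$ has the form $g(\psi\cdot,\psi\cdot)$ with $\psi\in\mathrm{Aut}(\mathfrak g)$. (ii) If $\mathbb K=\mathbb R$ and $\mathfrak g$ is irreducible (not a direct sum of two nonzero ideals), every ad-invariant metric on $\mathfrak g$ has the form $\pm g(\psi\cdot,\psi\cdot)$ with $\psi\in\mathrm{Aut}(\mathfrak g)$. (iii) If $\mathbb K=\mathbb R$ and $\mathfrak g=\mathfrak g_1\oplus\dots\oplus\mathfrak g_k$ is any decomposition into pairwise $g$-orthogonal ideals that are irreducible Lie algebras, with $g=g_1+\dots+g_k$ accordingly, then every ad-invariant metric on $\mathfrak g$ has the form $h(\psi\cdot,\psi\cdot)$ with $\psi\in\mathrm{Aut}(\mathfrak g)$ and $h=\pm g_1\pm\dots\pm g_k$ for some choice of signs. -/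

import Mathlib

namespace SolitaryLie

section

variable {K L : Type*} [CommRing K] [LieRing L] [LieAlgebra K L]

/-- An ad-invariant metric on a Lie algebra: a nondegenerate symmetric bilinear form `B`
with `B ⁅x, y⁆ z = -B y ⁅x, z⁆`. (Over `ℂ` it is complex bilinear; over `ℝ` any signature
is allowed.) -/
structure IsAdInvariantMetric (B : LinearMap.BilinForm K L) : Prop where
  isSymm : B.IsSymm
  nondegenerate : B.Nondegenerate
  invariant : B.lieInvariant L

/-- An endomorphism `φ` of the vector space `L` is ad-invariant if `φ ⁅x, y⁆ = ⁅x, φ y⁆`. -/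
def IsAdInvariantEnd (φ : L →ₗ[K] L) : Prop :=
  ∀ x y : L, φ ⁅x, y⁆ = ⁅x, φ y⁆

/-- `B` is solitary if every ad-invariant `B`-self-adjoint endomorphism is `D + D'` for some
derivation `D` of `L`, where `D'` is the adjoint of `D` with respect to `B`
(unique, since `B` is nondegenerate in all uses). -/
def IsSolitary (B : LinearMap.BilinForm K L) : Prop :=
  ∀ φ : L →ₗ[K] L, IsAdInvariantEnd φ → (∀ x y : L, B (φ x) y = B x (φ y)) →
    ∃ (D : LieDerivation K L L) (D' : L →ₗ[K] L),
      (∀ x y : L, B (D x) y = B x (D' y)) ∧ φ = (D : L →ₗ[K] L) + D'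

/-- A linear map `φ : L → L*` is ad-invariant if `φ ⁅x, y⁆ = ⁅x, φ y⁆`, where `L` acts on `L*`
by the coadjoint action `⁅x, α⁆ = -α ∘ ad x`. -/
def IsAdInvariantToDual (φ : L →ₗ[K] Module.Dual K L) : Prop :=
  ∀ x y : L, φ ⁅x, y⁆ = ⁅x, φ y⁆

/-- `L` is `T*`-solitary if every ad-invariant symmetric linear map `φ : L → L*` is `D + Dᵗ` for
some derivation `D : L → L*`. Here `L*` carries the coadjoint action, so that the Leibniz rule
reads `D ⁅x, y⁆ = ⁅x, D y⁆ - ⁅y, D x⁆`; equivalently, the extension of `D` by zero is a derivation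
of the cotangent Lie algebra `L ⋉ L*`. The transpose is `Dᵗ x y = D y x`. -/
def IsTStarSolitary (K L : Type*) [CommRing K] [LieRing L] [LieAlgebra K L] : Prop :=
  ∀ φ : L →ₗ[K] Module.Dual K L, IsAdInvariantToDual φ → (∀ x y : L, φ x y = φ y x) →
    ∃ D : LieDerivation K L (Module.Dual K L),
      ∀ x y : L, φ x y = D x y + D y x

/-- A Lie algebra is irreducible if it is not a direct sum of two nonzero ideals. -/
def IsIrreducibleLie (K L : Type*) [CommRing K] [LieRing L] [LieAlgebra K L] : Prop :=
  ∀ I J : LieIdeal K L, IsCompl I J → I = ⊥ ∨ J = ⊥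

/-- The ideals `I i` are pairwise `B`-orthogonal. -/
def IsOrthogonalFamily {k : ℕ} (B : LinearMap.BilinForm K L) (I : Fin k → LieIdeal K L) : Prop :=
  ∀ i j : Fin k, i ≠ j → ∀ x ∈ I i, ∀ y ∈ I j, B x y = 0

/-- `L` is the direct sum of the pairwise `B`-orthogonal ideals `I i`, each of which is
irreducible as a Lie algebra. -/
structure IsOrthogonalIrreducibleDecomposition {k : ℕ} (B : LinearMap.BilinForm K L)
    (I : Fin k → LieIdeal K L) : Prop where
  isInternal : DirectSum.IsInternal fun i => (I i).toSubmodule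
  orthogonal : IsOrthogonalFamily B I
  irreducible : ∀ i, IsIrreducibleLie K (I i)

/-- `h = ε₁ B₁ + ⋯ + εₖ Bₖ`, where `Bᵢ` is the restriction of `B` to `I i`, for a direct sum
decomposition of `L` into the pairwise `B`-orthogonal ideals `I i`. -/
def IsRescalingAlong {k : ℕ} (B : LinearMap.BilinForm K L) (I : Fin k → LieIdeal K L)
    (ε : Fin k → K) (h : LinearMap.BilinForm K L) : Prop :=
  IsOrthogonalFamily h I ∧ ∀ i, ∀ x ∈ I i, ∀ y ∈ I i, h x y = ε i * B x y

end

end SolitaryLie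

/-! Everything rests on one structural fact, `lie_perp_orthogonal`: a nonabelian solvable metric Lie
algebra of dimension at most six has a central isotropic vector `c` such that brackets of vectors in
`c^⊥` lie in the line of `c`. With an isotropic `d` pairing to one with `c`, the algebra is `K c ⊕ V
⊕ K d`, where `ad d` preserves `V` and brackets of vectors in `V` are multiples of `c`. Hence the
weights 1, 1/2, 0 on `c`, `V`, `d` define a derivation with `D + D^* = id`, and `l^2`, `l`, 1 define
an automorphism scaling the metric by `l^2`.

Solitarity: a symmetric ad-invariant `φ : L → L^*` induces a metric on `L / ker φ`, again solvable
of dimension at most six, and the derivation found there pulls back. A metric identifies `L` with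
`L^*`, which gives the second claim.

Uniqueness: two metrics are proportional on `⁅L, L⁆ × L`, and the scalings remove the factor modulo
squares. What remains is a Witt-type problem. Since `⁅L, L⁆^⊥` is the center, only a complement `U`
of the isotropic part of the center matters. If the forms are isometric on `U`, some isometry fixes
`⁅L, L⁆` pointwise; it moves vectors by central ones, so it is an automorphism. Over `ℂ` the forms
on `U` are always isometric. Over `ℝ`, `U` is spanned by the one-dimensional summands, whose signs
are free, while all other summands take the sign of the factor. -/

namespace SolitaryLie

/-! ### Invariance identities and solvability -/

section Metric

variable {K L : Type*} [Field K] [LieRing L] [LieAlgebra K L]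

/-- In a solvable Lie algebra, an ideal that is perfect modulo another ideal is contained in it. -/
theorem le_of_le_sup_lie [LieAlgebra.IsSolvable L] {H J : LieIdeal K L}
    (h : H ≤ J ⊔ ⁅H, H⁆) : H ≤ J := by
  -- Substituting the inclusion into itself replaces `⁅H, H⁆` by ever deeper derived terms, which
  -- end at zero.
  have key : ∀ n, H ≤ J ⊔ LieAlgebra.derivedSeriesOfIdeal K L n H := by
    intro n
    induction n with
    | zero => simp
    | succ n ih =>
      rw [LieAlgebra.derivedSeriesOfIdeal_succ]
      refine h.trans (sup_le le_sup_left ?_)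
      refine (LieSubmodule.mono_lie ih ih).trans ?_
      rw [LieSubmodule.lie_sup, LieSubmodule.sup_lie, LieSubmodule.sup_lie]
      refine sup_le (sup_le ?_ ?_) (sup_le ?_ le_sup_right)
      · exact LieSubmodule.lie_le_left _ _ |>.trans le_sup_left
      · exact LieSubmodule.lie_le_right _ _ |>.trans le_sup_left
      · exact LieSubmodule.lie_le_left _ _ |>.trans le_sup_left
  obtain ⟨n, hn⟩ := LieAlgebra.IsSolvable.solvable K L
  have h1 := key n
  have h2 : LieAlgebra.derivedSeriesOfIdeal K L n H ≤ ⊥ := by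
    rw [← hn]
    exact LieAlgebra.derivedSeriesOfIdeal_mono le_top n
  rw [le_bot_iff.mp h2, sup_bot_eq] at h1
  exact h1

namespace IsAdInvariantMetric

variable {B : LinearMap.BilinForm K L}

theorem symm (hB : IsAdInvariantMetric B) (x y : L) : B x y = B y x := hB.isSymm.eq x y

theorem inv_left (hB : IsAdInvariantMetric B) (x y z : L) : B ⁅x, y⁆ z = - B y ⁅x, z⁆ :=
  hB.invariant x y z

theorem lie_left (hB : IsAdInvariantMetric B) (x y z : L) : B ⁅x, y⁆ z = B x ⁅y, z⁆ := by
  rw [← lie_skew, map_neg, LinearMap.neg_apply, hB.inv_left, neg_neg]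

/-- Invariance makes `B ⁅x, y⁆ z` an alternating 3-form, the main tool below. -/
theorem rot (hB : IsAdInvariantMetric B) (x y z : L) : B ⁅x, y⁆ z = B ⁅y, z⁆ x := by
  rw [hB.lie_left, hB.symm]

theorem lie_self_right (hB : IsAdInvariantMetric B) (x y : L) : B ⁅x, y⁆ y = 0 := by
  rw [hB.lie_left, lie_self, map_zero]

theorem lie_self_left (hB : IsAdInvariantMetric B) (x y : L) : B ⁅x, y⁆ x = 0 := by
  rw [hB.symm, ← hB.lie_left, lie_self, map_zero, LinearMap.zero_apply]

theorem eq_zero (hB : IsAdInvariantMetric B) {x : L} (h : ∀ y, B x y = 0) : x = 0 :=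
  hB.nondegenerate.1 x h

theorem eq_of (hB : IsAdInvariantMetric B) {x y : L} (h : ∀ z, B x z = B y z) : x = y := by
  rw [← sub_eq_zero]
  exact hB.eq_zero fun z => by simp [h z]

theorem exists_repr [FiniteDimensional K L] (hB : IsAdInvariantMetric B) (f : Module.Dual K L) :
    ∃ a, ∀ x, B a x = f x :=
  ⟨(B.toDual hB.nondegenerate).symm f, fun x => by simp⟩

theorem exists_repr_of_notMem [FiniteDimensional K L] (hB : IsAdInvariantMetric B)
    {p : Submodule K L} {x : L} (hx : x ∉ p) : ∃ a, B a x ≠ 0 ∧ ∀ y ∈ p, B a y = 0 := by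
  obtain ⟨f, hf, hp⟩ := Submodule.exists_le_ker_of_notMem hx
  obtain ⟨a, ha⟩ := hB.exists_repr f
  exact ⟨a, by rwa [ha], fun y hy => by rw [ha]; exact hp hy⟩

/-- A vector orthogonal to `c^⊥` is a multiple of `c`. -/
theorem exists_smul_of_orthogonal (hB : IsAdInvariantMetric B) {c d x : L} (hcd : B c d = 1)
    (hx : ∀ y, B c y = 0 → B x y = 0) : x = B x d • c := by
  refine hB.eq_of fun z => ?_
  have := hx (z - B c z • d) (by simp [hcd])
  simp only [map_sub, map_smul, smul_eq_mul, LinearMap.smul_apply] at this ⊢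
  linear_combination this

end IsAdInvariantMetric

/-- An ideal is not perfect modulo a smaller ideal, so there is a functional, represented by
the metric, that detects this. -/
theorem exists_orthogonal_of_not_le [FiniteDimensional K L] [LieAlgebra.IsSolvable L]
    {B : LinearMap.BilinForm K L} (hB : IsAdInvariantMetric B) {H J : LieIdeal K L}
    (h : ¬ H ≤ J) : ∃ k, (∃ x ∈ H, B k x ≠ 0) ∧ (∀ x ∈ J, B k x = 0) ∧
      ∀ x ∈ H, ∀ y ∈ H, B k ⁅x, y⁆ = 0 := by
  have h' : ¬ H ≤ J ⊔ ⁅H, H⁆ := fun h' => h (le_of_le_sup_lie h')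
  obtain ⟨x, hx, hx'⟩ := SetLike.not_le_iff_exists.mp h'
  obtain ⟨k, hk, hk'⟩ := hB.exists_repr_of_notMem (p := (J ⊔ ⁅H, H⁆).toSubmodule) hx'
  refine ⟨k, ⟨x, hx, hk⟩, fun y hy => hk' y ?_, fun y hy z hz => hk' _ ?_⟩
  · exact (le_sup_left : J ≤ J ⊔ ⁅H, H⁆) hy
  · exact (le_sup_right : ⁅H, H⁆ ≤ J ⊔ ⁅H, H⁆) (LieSubmodule.lie_mem_lie hy hz)

end Metric

/-! ### The 3-form `B ⁅x, y⁆ z` in dimension at most six -/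

section LowDim

variable {K L : Type*} [Field K] [LieRing L] [LieAlgebra K L]
variable {B : LinearMap.BilinForm K L}

/-- The three functionals are dual to `e₁, e₂, e₃`, so their common kernel has dimension at most 6 -
3 = 3 and cannot hold four independent vectors. The bound six enters only through this count. -/
theorem exists_relation_of_triple [FiniteDimensional K L] (hB : IsAdInvariantMetric B) (hdim : Module.finrank K L ≤ 6)
    {e₁ e₂ e₃ : L} (he : B ⁅e₁, e₂⁆ e₃ = 1) (v : Fin 4 → L)
    (hv : ∀ i, B ⁅e₂, e₃⁆ (v i) = 0 ∧ B ⁅e₃, e₁⁆ (v i) = 0 ∧ B ⁅e₁, e₂⁆ (v i) = 0) :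
    ∃ a : Fin 4 → K, ∑ i, a i • v i = 0 ∧ ∃ i, a i ≠ 0 := by
  let f : L →ₗ[K] (Fin 3 → K) := LinearMap.pi ![B ⁅e₂, e₃⁆, B ⁅e₃, e₁⁆, B ⁅e₁, e₂⁆]
  have hf : Function.Surjective f := by
    intro a
    refine ⟨a 0 • e₁ + a 1 • e₂ + a 2 • e₃, ?_⟩
    have h1 : B ⁅e₂, e₃⁆ e₁ = 1 := by rw [← hB.rot, he]
    have h2 : B ⁅e₃, e₁⁆ e₂ = 1 := by rw [hB.rot, he]
    ext i
    fin_cases i <;>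
      simp [f, he, h1, h2, hB.lie_self_left, hB.lie_self_right]
  have hker : Module.finrank K (LinearMap.ker f) ≤ 3 := by
    have := LinearMap.finrank_range_add_finrank_ker f
    rw [LinearMap.range_eq_top.mpr hf, finrank_top, Module.finrank_fin_fun] at this
    omega
  let w : Fin 4 → LinearMap.ker f := fun i => ⟨v i, by
    rw [LinearMap.mem_ker]
    ext j
    obtain ⟨h1, h2, h3⟩ := hv i
    fin_cases j <;> simp [f, h1, h2, h3]⟩
  have hw : ¬ LinearIndependent K w := fun h => by
    have := h.fintype_card_le_finrank
    simp at this
    omega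
  obtain ⟨g, hg, hi⟩ := Fintype.not_linearIndependent_iff.mp hw
  refine ⟨g, ?_, hi⟩
  have := congrArg (LinearMap.ker f).subtype hg
  simpa [w] using this

/-- The component of `u` complementary to `e₁, e₂, e₃` determined by the form `B ⁅x, y⁆ z`. -/
def tripleRemainder (B : LinearMap.BilinForm K L) (e₁ e₂ e₃ u : L) : L :=
  u - B ⁅e₂, e₃⁆ u • e₁ - B ⁅e₃, e₁⁆ u • e₂ - B ⁅e₁, e₂⁆ u • e₃

theorem tripleRemainder_spec (hB : IsAdInvariantMetric B) {e₁ e₂ e₃ : L}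
    (he : B ⁅e₁, e₂⁆ e₃ = 1) (u : L) :
    B ⁅e₂, e₃⁆ (tripleRemainder B e₁ e₂ e₃ u) = 0 ∧
      B ⁅e₃, e₁⁆ (tripleRemainder B e₁ e₂ e₃ u) = 0 ∧
      B ⁅e₁, e₂⁆ (tripleRemainder B e₁ e₂ e₃ u) = 0 := by
  have h1 : B ⁅e₂, e₃⁆ e₁ = 1 := by rw [← hB.rot, he]
  have h2 : B ⁅e₃, e₁⁆ e₂ = 1 := by rw [hB.rot, he]
  refine ⟨?_, ?_, ?_⟩ <;>
    simp [tripleRemainder, he, h1, h2, hB.lie_self_left, hB.lie_self_right]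

theorem tripleRemainder_apply {e₁ e₂ e₃ a : L} (u : L) (h1 : B a e₁ = 0) (h2 : B a e₂ = 0)
    (h3 : B a e₃ = 0) : B a (tripleRemainder B e₁ e₂ e₃ u) = B a u := by
  simp [tripleRemainder, h1, h2, h3]

/-- A vector orthogonal to all brackets is central; `exists_orthogonal_of_not_le` finds one that is
also orthogonal to the center, hence to itself. -/
theorem exists_central_isotropic [FiniteDimensional K L] (hB : IsAdInvariantMetric B)
    [LieAlgebra.IsSolvable L]
    (hna : ∃ x y : L, ⁅x, y⁆ ≠ 0) :
    ∃ c d : L, (∀ x : L, ⁅c, x⁆ = 0) ∧ B c d = 1 ∧ ∀ z, (∀ x : L, ⁅z, x⁆ = 0) → B c z = 0 := by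
  have hle : ¬ (⊤ : LieIdeal K L) ≤ LieAlgebra.center K L := by
    intro h
    obtain ⟨x, y, hxy⟩ := hna
    have := h (LieSubmodule.mem_top y)
    rw [LieModule.mem_maxTrivSubmodule] at this
    exact hxy (this x)
  obtain ⟨c, ⟨x, -, hx⟩, hJ, hH⟩ := exists_orthogonal_of_not_le hB hle
  refine ⟨c, (B c x)⁻¹ • x, fun u => hB.eq_zero fun v => ?_, by simp [hx], fun z hz => hJ z ?_⟩
  · rw [hB.lie_left]
    exact hH _ (LieSubmodule.mem_top _) _ (LieSubmodule.mem_top _)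
  · rw [LieModule.mem_maxTrivSubmodule]
    intro u
    rw [← lie_skew, hz, neg_zero]

/-- The orthogonal complement of a central vector, as an ideal. -/
def perpIdeal (hB : IsAdInvariantMetric B) (c : L) (hc : ∀ x : L, ⁅c, x⁆ = 0) : LieIdeal K L where
  __ := LinearMap.ker (B c)
  lie_mem := by
    intro x m _
    change B c ⁅x, m⁆ = 0
    rw [← hB.lie_left, hc, map_zero, LinearMap.zero_apply]

/-- The elements of `H` orthogonal to `⁅H, H⁆`, as an ideal. -/
def innerPerp (hB : IsAdInvariantMetric B) (H : LieIdeal K L) : LieIdeal K L where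
  carrier := {x | x ∈ H ∧ ∀ u ∈ H, ∀ v ∈ H, B x ⁅u, v⁆ = 0}
  add_mem' := fun {x y} hx hy => ⟨add_mem hx.1 hy.1, fun u hu v hv => by
    simp [hx.2 u hu v hv, hy.2 u hu v hv]⟩
  zero_mem' := ⟨zero_mem _, by simp⟩
  smul_mem' := fun a x hx => ⟨H.smul_mem a hx.1, fun u hu v hv => by simp [hx.2 u hu v hv]⟩
  lie_mem := by
    rintro y x ⟨hx, hx'⟩
    refine ⟨H.lie_mem hx, fun u hu v hv => ?_⟩
    rw [hB.inv_left, leibniz_lie, map_add, hx' _ (H.lie_mem hu) _ hv, hx' _ hu _ (H.lie_mem hv),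
      add_zero, neg_zero]

end LowDim

/-! ### Brackets on the orthogonal complement of a central isotropic vector -/

section LowDim

variable {K L : Type*} [Field K] [LieRing L] [LieAlgebra K L]
variable {B : LinearMap.BilinForm K L}

/-- Vectors `c, k, e₁, d` with `c, k` isotropic and orthogonal, detected by the pairings with `c`,
`k`, `x₀` and `d`, are linearly independent. -/
theorem eq_zero_of_relation (hB : IsAdInvariantMetric B) {c k d x₀ e₁ : L} {a b g t : K}
    (hcc : B c c = 0) (hck : B c k = 0) (hce : B c e₁ = 0) (hcd : B c d = 1)
    (hkk : B k k = 0) (hke : B k e₁ ≠ 0) (hcx : B c x₀ = 0) (hkx : B k x₀ ≠ 0)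
    (h : a • c + b • k + g • e₁ + t • d = 0) : a = 0 ∧ b = 0 ∧ g = 0 ∧ t = 0 := by
  have ht : t = 0 := by
    have := congrArg (B c) h
    simpa [hcc, hck, hce, hcd] using this
  subst ht
  have hg : g = 0 := by
    have := congrArg (B k) h
    simpa [hkk, hB.symm k c, hck, hke] using this
  subst hg
  have hb : b = 0 := by
    have := congrArg (B x₀) h
    simpa [hB.symm x₀ k, hB.symm x₀ c, hcx, hkx] using this
  subst hb
  have ha : a = 0 := by
    have := congrArg (B d) h
    simpa [hB.symm d c, hcd] using this
  exact ⟨ha, rfl, rfl, rfl⟩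

/-- An element whose brackets with `e₁, e₂, e₃` are orthogonal to the `eᵢ`, and which commutes
with all remainders, is central. -/
theorem lie_eq_zero_of_triple (hB : IsAdInvariantMetric B) {e₁ e₂ e₃ z : L}
    (h12 : B ⁅e₁, e₂⁆ z = 0) (h23 : B ⁅e₂, e₃⁆ z = 0) (h31 : B ⁅e₃, e₁⁆ z = 0)
    (hrem : ∀ u, ⁅z, tripleRemainder B e₁ e₂ e₃ u⁆ = 0) (u : L) : ⁅z, u⁆ = 0 := by
  have hexp : ∀ u, ⁅z, u⁆ = B ⁅e₂, e₃⁆ u • ⁅z, e₁⁆ + B ⁅e₃, e₁⁆ u • ⁅z, e₂⁆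
      + B ⁅e₁, e₂⁆ u • ⁅z, e₃⁆ := by
    intro u
    have := hrem u
    simp only [tripleRemainder, lie_sub, lie_smul] at this
    rw [← sub_eq_zero, ← this]
    abel
  have a12 : B ⁅z, e₁⁆ e₂ = 0 := by rw [hB.rot, h12]
  have a23 : B ⁅z, e₂⁆ e₃ = 0 := by rw [hB.rot, h23]
  have a31 : B ⁅z, e₃⁆ e₁ = 0 := by rw [hB.rot, h31]
  have sw : ∀ x y, B ⁅z, x⁆ y = - B ⁅z, y⁆ x := fun x y => by
    rw [hB.inv_left, hB.symm]
  have a21 : B ⁅z, e₂⁆ e₁ = 0 := by rw [sw, a12, neg_zero]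
  have a32 : B ⁅z, e₃⁆ e₂ = 0 := by rw [sw, a23, neg_zero]
  have a13 : B ⁅z, e₁⁆ e₃ = 0 := by rw [sw, a31, neg_zero]
  have z1 : ⁅z, e₁⁆ = 0 := hB.eq_zero fun v => by
    rw [sw, hexp v]; simp [hB.lie_self_right, a21, a31]
  have z2 : ⁅z, e₂⁆ = 0 := hB.eq_zero fun v => by
    rw [sw, hexp v]; simp [hB.lie_self_right, a12, a32]
  have z3 : ⁅z, e₃⁆ = 0 := hB.eq_zero fun v => by
    rw [sw, hexp v]; simp [hB.lie_self_right, a13, a23]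
  rw [hexp, z1, z2, z3]
  simp

/-- In a solvable metric Lie algebra of dimension at most six, the bracket of the orthogonal
complement of a suitable isotropic central vector `c` takes values in the line spanned by `c`. -/
theorem lie_perp_orthogonal [FiniteDimensional K L] (hB : IsAdInvariantMetric B)
    [LieAlgebra.IsSolvable L] (hdim : Module.finrank K L ≤ 6) {c d : L}
    (hc : ∀ x : L, ⁅c, x⁆ = 0) (hcd : B c d = 1)
    (hcZ : ∀ z, (∀ x : L, ⁅z, x⁆ = 0) → B c z = 0)
    {x₁ x₂ x₃ : L} (hx₁ : B c x₁ = 0) (hx₂ : B c x₂ = 0) (hx₃ : B c x₃ = 0) :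
    B ⁅x₁, x₂⁆ x₃ = 0 := by
  by_contra hne
  have hcc : B c c = 0 := hcZ c hc
  have hcl : ∀ x y : L, B c ⁅x, y⁆ = 0 := fun x y => by
    rw [← hB.lie_left, hc, map_zero, LinearMap.zero_apply]
  have hcl' : ∀ x y : L, B ⁅x, y⁆ c = 0 := fun x y => by rw [hB.symm, hcl]
  -- If the 3-form is nonzero on `c^⊥`, its radical `innerPerp` is a proper subideal. The detecting
  -- vector `k` lies in that radical and is orthogonal to it, so it is isotropic.
  obtain ⟨k, ⟨x₀, hx₀, hkx⟩, hkK, hkH⟩ := exists_orthogonal_of_not_le hB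
    (H := perpIdeal hB c hc) (J := innerPerp hB (perpIdeal hB c hc)) (fun h => hne (by
      rw [hB.lie_left]; exact (h hx₁).2 _ hx₂ _ hx₃))
  have hcx : B c x₀ = 0 := hx₀
  have hkc : B k c = 0 := hkK c ⟨hcc, fun u _ v _ => hcl u v⟩
  have hck : B c k = 0 := by rw [hB.symm, hkc]
  have hkmem : k ∈ innerPerp hB (perpIdeal hB c hc) := ⟨hck, hkH⟩
  have hkk : B k k = 0 := hkK k hkmem
  have hkH' : ∀ x y, B c x = 0 → B c y = 0 → B ⁅x, y⁆ k = 0 := fun x y hx hy => by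
    rw [hB.symm]; exact hkH x hx y hy
  -- the form vanishes on `c^⊥ ∩ k^⊥`
  have F1 : ∀ x y z, B c x = 0 → B c y = 0 → B c z = 0 → B k x = 0 → B k y = 0 → B k z = 0 →
      B ⁅x, y⁆ z = 0 := by
    intro x y z hx hy hz hx' hy' hz'
    by_contra hn
    set w := (B ⁅x, y⁆ z)⁻¹ • z with hw
    have hcw : B c w = 0 := by simp [hw, hz]
    have hkw : B k w = 0 := by simp [hw, hz']
    have he : B ⁅x, y⁆ w = 1 := by simp [hw, hn]
    -- The vectors `c`, `k` and the remainders of `x₀` and `d` would be four independent vectors in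
    -- a kernel of dimension at most three.
    obtain ⟨a, ha, i, hi⟩ := exists_relation_of_triple hB hdim he
      ![c, k, tripleRemainder B x y w x₀, tripleRemainder B x y w d] (by
        intro i
        fin_cases i
        · simp [hcl']
        · simp [hkH', hx, hy, hcw]
        · exact tripleRemainder_spec hB he x₀
        · exact tripleRemainder_spec hB he d)
    have hrel := eq_zero_of_relation hB (a := a 0) (b := a 1) (g := a 2) (t := a 3)
      (d := tripleRemainder B x y w d)
      (e₁ := tripleRemainder B x y w x₀) hcc hck
      (by rw [tripleRemainder_apply _ hx hy hcw, hcx])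
      (by rw [tripleRemainder_apply _ hx hy hcw, hcd]) hkk
      (by rwa [tripleRemainder_apply _ hx' hy' hkw]) hcx hkx
      (by simpa [Fin.sum_univ_four] using ha)
    apply hi
    fin_cases i
    exacts [hrel.1, hrel.2.1, hrel.2.2.1, hrel.2.2.2]
  -- a triple adapted to `k`
  obtain ⟨e₁, e₂, e₃, hc1, hc2, hc3, hk1, hk2, hk3, he⟩ : ∃ e₁ e₂ e₃, B c e₁ = 0 ∧ B c e₂ = 0 ∧
      B c e₃ = 0 ∧ B k e₁ = 1 ∧ B k e₂ = 0 ∧ B k e₃ = 0 ∧ B ⁅e₁, e₂⁆ e₃ = 1 := by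
    set e := (B k x₀)⁻¹ • x₀ with he
    have hce : B c e = 0 := by simp [he, hcx]
    have hke : B k e = 1 := by simp [he, hkx]
    by_cases hall : ∀ u v, B c u = 0 → B c v = 0 → B k u = 0 → B k v = 0 → B ⁅e, u⁆ v = 0
    -- Subtracting multiples of `e` moves each `xᵢ` into `c^⊥ ∩ k^⊥`. Terms without `e` vanish by
    -- `F1`, terms with one `e` by `hall`, the others by alternation.
    · exfalso
      apply hne
      have hcp : ∀ u, B c u = 0 → B c (u - B k u • e) = 0 := fun u hu => by simp [hu, hce]
      have hkp : ∀ u, B k (u - B k u • e) = 0 := fun u => by simp [hke]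
      have h0 := F1 _ _ _ (hcp _ hx₁) (hcp _ hx₂) (hcp _ hx₃) (hkp _) (hkp _) (hkp _)
      have h1 := hall _ _ (hcp _ hx₂) (hcp _ hx₃) (hkp _) (hkp _)
      have h2 := hall _ _ (hcp _ hx₃) (hcp _ hx₁) (hkp _) (hkp _)
      have h3 := hall _ _ (hcp _ hx₁) (hcp _ hx₂) (hkp _) (hkp _)
      rw [hB.rot e] at h1 h2 h3
      simp only [lie_sub, sub_lie, lie_smul, smul_lie, lie_self, map_sub, map_smul,
        LinearMap.sub_apply, LinearMap.smul_apply, smul_eq_mul, smul_zero, sub_zero,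
        hB.lie_self_left, hB.lie_self_right, mul_zero] at h0 h1 h2 h3
      have r1 : B ⁅x₁, e⁆ x₃ = B ⁅x₃, x₁⁆ e := by rw [hB.rot x₃ x₁ e]
      have r2 : B ⁅e, x₂⁆ x₃ = B ⁅x₂, x₃⁆ e := by rw [hB.rot e]
      linear_combination h0 + (B k x₁) * h1 + (B k x₂) * h2 + (B k x₃) * h3 + (B k x₂) * r1
        + (B k x₁) * r2
    · push Not at hall
      obtain ⟨u, v, hu, hv, hu', hv', huv⟩ := hall
      exact ⟨e, u, (B ⁅e, u⁆ v)⁻¹ • v, hce, hu, by simp [hv], hke, hu', by simp [hv'],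
        by simp [huv]⟩
  set d' := tripleRemainder B e₁ e₂ e₃ d with hd'
  have hd'spec := tripleRemainder_spec hB he d
  have hcd' : B c d' = 1 := by rw [hd', tripleRemainder_apply _ hc1 hc2 hc3, hcd]
  have span : ∀ u, B ⁅e₂, e₃⁆ u = 0 ∧ B ⁅e₃, e₁⁆ u = 0 ∧ B ⁅e₁, e₂⁆ u = 0 →
      ∃ α β : K, u = α • c + β • k + B c u • d' := by
    intro u hu
    obtain ⟨a, ha, i, hi⟩ := exists_relation_of_triple hB hdim he ![c, k, u, d'] (by
        intro i
        fin_cases i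
        · simp [hcl']
        · simp [hkH', hc1, hc2, hc3]
        · exact hu
        · exact hd'spec)
    have ha : a 0 • c + a 1 • k + a 2 • u + a 3 • d' = 0 := by
      simpa [Fin.sum_univ_four] using ha
    have h2 : a 2 ≠ 0 := by
      -- If the coefficient of `u` vanishes, `u` may be replaced by `e₁`, to which the independence
      -- criterion applies.
      intro h2
      have h2' : a 0 • c + a 1 • k + a 2 • e₁ + a 3 • d' = 0 := by
        rw [h2] at ha ⊢
        simpa using ha
      have hrel := eq_zero_of_relation hB (x₀ := x₀) hcc hck hc1 hcd' hkk
        (by rw [hk1]; exact one_ne_zero) hcx hkx h2'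
      apply hi
      fin_cases i
      exacts [hrel.1, hrel.2.1, hrel.2.2.1, hrel.2.2.2]
    have hcu : a 2 * B c u + a 3 = 0 := by
      have := congrArg (B c) ha
      simpa [hcc, hck, hcd'] using this
    refine ⟨-(a 0 / a 2), -(a 1 / a 2), ?_⟩
    have h3 : a 3 = - (a 2 * B c u) := by linear_combination hcu
    have : a 2 • u = - (a 0 • c) - a 1 • k + (a 2 * B c u) • d' := by
      rw [h3] at ha
      rw [← sub_eq_zero, ← ha, neg_smul]
      abel
    refine smul_right_injective L h2 ?_
    change a 2 • u = a 2 • _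
    rw [this, smul_add, smul_add, smul_smul, smul_smul, smul_smul, mul_neg, mul_neg,
      mul_div_cancel₀ _ h2, mul_div_cancel₀ _ h2, neg_smul, neg_smul]
    abel
  have span' : ∀ u, B c u = 0 → B ⁅e₂, e₃⁆ u = 0 ∧ B ⁅e₃, e₁⁆ u = 0 ∧ B ⁅e₁, e₂⁆ u = 0 →
      ∃ α β : K, u = α • c + β • k := by
    intro u hu hu'
    obtain ⟨α, β, h⟩ := span u hu'
    exact ⟨α, β, by simpa [hu] using h⟩
  have K1 : ∀ y : L, ∃ α β : K, ⁅y, k⁆ = α • c + β • k := by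
    intro y
    have hm := LieSubmodule.lie_mem (innerPerp hB (perpIdeal hB c hc)) (x := y) hkmem
    refine span' _ hm.1 ⟨?_, ?_, ?_⟩ <;> rw [hB.symm]
    exacts [hm.2 _ hc2 _ hc3, hm.2 _ hc3 _ hc1, hm.2 _ hc1 _ hc2]
  have kw : ∀ w, B c w = 0 → B k w = 0 → ⁅k, w⁆ = 0 := by
    intro w hw hw'
    refine hB.eq_zero fun y => ?_
    obtain ⟨α, β, h⟩ := K1 y
    rw [hB.rot, ← hB.rot, ← hB.rot, h]
    simp [hw, hw']
  set q := ⁅e₂, e₃⁆ with hq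
  -- `W = c^⊥ ∩ k^⊥` is spanned by `e₂, e₃, c, k`, and `c`, `k` commute with `W`. As `W` is an
  -- ideal, the line of `q` will be one too.
  have WW : ∀ w w' : L, B c w = 0 → B k w = 0 → B c w' = 0 → B k w' = 0 → ∃ s : K, ⁅w, w'⁆ = s • q := by
    have dec : ∀ w, B c w = 0 → B k w = 0 → ∃ f g α β : K,
        w = f • e₂ + g • e₃ + α • c + β • k := by
      intro w hw hw'
      obtain ⟨α, β, h⟩ := span' (tripleRemainder B e₁ e₂ e₃ w)
        (by rw [tripleRemainder_apply _ hc1 hc2 hc3, hw]) (tripleRemainder_spec hB he w)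
      have h1 := F1 _ _ _ hc2 hc3 hw hk2 hk3 hw'
      refine ⟨B ⁅e₃, e₁⁆ w, B ⁅e₁, e₂⁆ w, α, β, ?_⟩
      rw [add_assoc _ _ (β • k), ← h, tripleRemainder, h1]
      module
    intro w w' hw hw' hv hv'
    obtain ⟨f, g, α, β, rfl⟩ := dec w hw hw'
    obtain ⟨f', g', α', β', rfl⟩ := dec w' hv hv'
    refine ⟨f * g' - g * f', ?_⟩
    have ck : ∀ x : L, ⁅x, c⁆ = 0 := fun x => by rw [← lie_skew, hc, neg_zero]
    have k2 := kw _ hc2 hk2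
    have k3 := kw _ hc3 hk3
    have k2' : ⁅e₂, k⁆ = 0 := by rw [← lie_skew, k2, neg_zero]
    have k3' : ⁅e₃, k⁆ = 0 := by rw [← lie_skew, k3, neg_zero]
    have hq' : ⁅e₃, e₂⁆ = - q := by rw [hq, lie_skew]
    simp only [add_lie, lie_add, smul_lie, lie_smul, lie_self, hc, ck, k2, k3, k2', k3', hq', ← hq]
    module
  have Wideal : ∀ y w : L, B c w = 0 → B k w = 0 → B k ⁅y, w⁆ = 0 := by
    intro y w hw hw'
    obtain ⟨α, β, h⟩ := K1 y
    rw [← hB.lie_left, ← lie_skew, h]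
    simp [hw, hw']
  have yq : ∀ y : L, ∃ s : K, ⁅y, q⁆ = s • q := by
    intro y
    obtain ⟨s, hs⟩ := WW _ _ (hcl y e₂) (Wideal y _ hc2 hk2) hc3 hk3
    obtain ⟨t, ht⟩ := WW _ _ hc2 hk2 (hcl y e₃) (Wideal y _ hc3 hk3)
    exact ⟨s + t, by rw [hq, leibniz_lie, hs, ht, add_smul]⟩
  have hqe : B q e₁ = 1 := by rw [hq, ← hB.rot, he]
  -- The eigenvalue `s` is read off by pairing with `e₁`, and `⁅y, e₁⁆` lies in `W`, where the
  -- 3-form vanishes. The resulting `⁅e₁, q⁆ = 0` then kills `s` for every `y`.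
  have qH : ∀ y : L, B c y = 0 → ⁅y, q⁆ = 0 := by
    intro y hy
    obtain ⟨s, hs⟩ := yq y
    have h1 : B ⁅y, q⁆ e₁ = s := by rw [hs]; simp [hqe]
    have h2 : B ⁅y, q⁆ e₁ = 0 := by
      rw [hB.inv_left, hq, F1 _ _ _ hc2 hc3 (hcl _ _) hk2 hk3 (hkH _ hy _ hc1), neg_zero]
    rw [hs, ← h1, h2, zero_smul]
  have qc : ∀ y : L, ⁅y, q⁆ = 0 := by
    intro y
    obtain ⟨s, hs⟩ := yq y
    have h1 : B ⁅y, q⁆ e₁ = s := by rw [hs]; simp [hqe]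
    have h2 : B ⁅y, q⁆ e₁ = 0 := by
      rw [hB.lie_left, ← lie_skew, qH _ hc1, neg_zero, map_zero]
    rw [hs, ← h1, h2, zero_smul]
  have kc : ∀ y : L, ⁅y, k⁆ = 0 := by
    obtain ⟨α, β, h⟩ := span' q (hcl _ _)
      ⟨F1 _ _ _ hc2 hc3 (hcl _ _) hk2 hk3 (hkH _ hc2 _ hc3),
        by rw [hB.lie_left, qc, map_zero] , by rw [hB.lie_left, qc, map_zero]⟩
    have hβ : β = 1 := by
      have := congrArg (fun u => B u e₁) h
      simpa [hqe, hc1, hk1] using this.symm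
    intro y
    have hk : k = q - α • c := by rw [h, hβ]; module
    rw [hk, lie_sub, qc, lie_smul, ← lie_skew, hc]
    simp
  -- Remainders are combinations of `c`, `k`, `d'`, with `c` and `k` central, so `d'` commutes with
  -- them all. Its centrality contradicts the orthogonality of `c` to the center.
  have hd'c : ∀ u : L, ⁅d', u⁆ = 0 := by
    refine lie_eq_zero_of_triple hB hd'spec.2.2 hd'spec.1 hd'spec.2.1 fun u => ?_
    obtain ⟨α, β, h⟩ := span _ (tripleRemainder_spec hB he u)
    rw [h, lie_add, lie_add, lie_smul, lie_smul, lie_smul, lie_self, kc, ← lie_skew, hc]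
    simp
  have := hcZ d' hd'c
  rw [hcd'] at this
  exact one_ne_zero this

end LowDim

/-! ### Double extensions and the derivation with `D + D^* = id` -/

section Derivation

variable {K L : Type*} [Field K] [LieRing L] [LieAlgebra K L]
variable {B : LinearMap.BilinForm K L}

/-- A hyperbolic pair exhibiting a metric Lie algebra as a double extension of an abelian one by
a line: `c` is central and the bracket of `c^⊥` takes values in the line spanned by `c`. -/
structure IsAbelianDoubleExtension (B : LinearMap.BilinForm K L) (c d : L) : Prop where
  central : ∀ x : L, ⁅c, x⁆ = 0
  self_left : B c c = 0
  pairing : B c d = 1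
  self_right : B d d = 0
  bracket : ∀ x y : L, ⁅x, y⁆ = B ⁅x, y⁆ d • c + B c x • ⁅d, y⁆ - B c y • ⁅d, x⁆

theorem exists_isAbelianDoubleExtension [CharZero K] [FiniteDimensional K L]
    [LieAlgebra.IsSolvable L] (hB : IsAdInvariantMetric B) (hdim : Module.finrank K L ≤ 6)
    (hna : ∃ x y : L, ⁅x, y⁆ ≠ 0) : ∃ c d : L, IsAbelianDoubleExtension B c d := by
  obtain ⟨c, d₀, hc, hcd₀, hcZ⟩ := exists_central_isotropic hB hna
  have hcc : B c c = 0 := hcZ c hc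
  have hcl : ∀ x y : L, B c ⁅x, y⁆ = 0 := fun x y => by
    rw [← hB.lie_left, hc, map_zero, LinearMap.zero_apply]
  set d := d₀ - (B d₀ d₀ / 2) • c with hd
  have hcd : B c d = 1 := by simp [hd, hcd₀, hcc]
  have hdd : B d d = 0 := by
    simp only [hd, map_sub, map_smul, LinearMap.sub_apply, LinearMap.smul_apply, smul_eq_mul,
      hB.symm d₀ c, hcd₀, hcc]
    ring
  refine ⟨c, d, hc, hcc, hcd, hdd, fun x y => ?_⟩
  have hp : ∀ u, B c (u - B c u • d) = 0 := fun u => by simp [hcd]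
  have hperp : ∀ z, B c z = 0 → B ⁅x - B c x • d, y - B c y • d⁆ z = 0 := fun z hz =>
    lie_perp_orthogonal hB hdim hc hcd hcZ (hp x) (hp y) hz
  have h := hB.exists_smul_of_orthogonal hcd hperp
  have hBd : B ⁅x - B c x • d, y - B c y • d⁆ d = B ⁅x, y⁆ d := by
    simp [lie_sub, sub_lie, hB.lie_self_right, hB.lie_self_left]
  rw [hBd] at h
  rw [← h]
  simp only [lie_sub, sub_lie, lie_smul, smul_lie, lie_self, ← lie_skew d x]
  module

/-- A solvable metric Lie algebra of dimension at most six has a derivation `D` such that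
`D + D^* = id`. -/
theorem exists_derivation [CharZero K] [FiniteDimensional K L] [LieAlgebra.IsSolvable L]
    (hB : IsAdInvariantMetric B) (hdim : Module.finrank K L ≤ 6) :
    ∃ D : LieDerivation K L L, ∀ x y, B (D x) y + B x (D y) = B x y := by
  by_cases hna : ∃ x y : L, ⁅x, y⁆ ≠ 0
  · obtain ⟨c, d, h⟩ := exists_isAbelianDoubleExtension hB hdim hna
    have hcr : ∀ x : L, ⁅x, c⁆ = 0 := fun x => by rw [← lie_skew, h.central, neg_zero]
    have hcl : ∀ x y : L, B c ⁅x, y⁆ = 0 := fun x y => by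
      rw [← hB.lie_left, h.central, map_zero, LinearMap.zero_apply]
    -- Eigenvalues 1 on `c`, 0 on `d`, and 1/2 on the orthogonal complement of both.
    let f : L →ₗ[K] L := (2 : K)⁻¹ • (LinearMap.id + (B d).smulRight c - (B c).smulRight d)
    have hf : ∀ x, f x = (2 : K)⁻¹ • (x + B d x • c - B c x • d) := fun x => rfl
    refine ⟨⟨f, fun x y => ?_⟩, fun x y => ?_⟩
    · rw [hf, hf, hf, hcl]
      simp only [lie_sub, lie_add, lie_smul, hcr]
      have hb : B d ⁅x, y⁆ • c = ⁅x, y⁆ - B c x • ⁅d, y⁆ + B c y • ⁅d, x⁆ := by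
        have := h.bracket x y
        rw [hB.symm] at this
        nth_rewrite 2 [this]
        abel
      rw [hb, ← lie_skew x y, ← lie_skew d y, ← lie_skew d x]
      module
    · change B (f x) y + B x (f y) = B x y
      rw [hf, hf]
      simp only [map_smul, map_add, map_sub, LinearMap.smul_apply, LinearMap.add_apply,
        LinearMap.sub_apply, smul_eq_mul, hB.symm x d, hB.symm x c]
      field_simp
      ring
  · push Not at hna
    refine ⟨⟨(2 : K)⁻¹ • LinearMap.id, fun x y => by simp [hna]⟩, fun x y => ?_⟩
    change B ((2 : K)⁻¹ • x) y + B x ((2 : K)⁻¹ • y) = B x y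
    simp only [map_smul, LinearMap.smul_apply, smul_eq_mul]
    field_simp
    ring

end Derivation

/-! ### `T^*`-solitarity and solitary metrics -/

section TStar

variable {K L : Type*} [Field K] [CharZero K] [LieRing L] [LieAlgebra K L]
  [FiniteDimensional K L] [LieAlgebra.IsSolvable L]

/-- Solvable Lie algebras of dimension at most six are `T^*`-solitary. -/
theorem isTStarSolitary_of_finrank_le (hdim : Module.finrank K L ≤ 6) :
    IsTStarSolitary K L := by
  intro φ hφ hsymm
  have hinv : ∀ x y z : L, φ ⁅x, y⁆ z = - φ y ⁅x, z⁆ := fun x y z => by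
    rw [hφ, Module.Dual.lie_apply]
  let N : LieIdeal K L :=
    { LinearMap.ker φ with
      lie_mem := by
        intro x m hm
        have hm' : φ m = 0 := hm
        change φ ⁅x, m⁆ = 0
        rw [hφ, hm', lie_zero] }
  have hN : ∀ x, x ∈ N ↔ φ x = 0 := fun x => Iff.rfl
  let C : LinearMap.BilinForm K (L ⧸ N) := LinearMap.liftQ₂ N.toSubmodule N.toSubmodule φ
    (fun x hx => hx) (fun x hx => by
      ext y
      change φ y x = 0
      have : φ x = 0 := hx
      rw [hsymm, this, LinearMap.zero_apply])
  have hC : ∀ x y : L, C (LieSubmodule.Quotient.mk x) (LieSubmodule.Quotient.mk y) = φ x y :=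
    fun x y => rfl
  have hsurj : Function.Surjective (LieSubmodule.Quotient.mk : L → L ⧸ N) :=
    Submodule.mkQ_surjective N.toSubmodule
  have hCs : ∀ x y, C x y = C y x := by
    intro x y
    obtain ⟨x, rfl⟩ := hsurj x
    obtain ⟨y, rfl⟩ := hsurj y
    rw [hC, hC, hsymm]
  have hsep : ∀ x, (∀ y, C x y = 0) → x = 0 := by
    intro x hx
    obtain ⟨x, rfl⟩ := hsurj x
    refine (Submodule.Quotient.mk_eq_zero N.toSubmodule).mpr ?_
    change φ x = 0
    ext y
    exact hx (LieSubmodule.Quotient.mk y)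
  have hCm : IsAdInvariantMetric C := by
    refine ⟨⟨hCs⟩, ⟨hsep, fun x hx => hsep x fun y => by rw [hCs, hx]⟩, fun x y z => ?_⟩
    obtain ⟨x, rfl⟩ := hsurj x
    obtain ⟨y, rfl⟩ := hsurj y
    obtain ⟨z, rfl⟩ := hsurj z
    rw [← LieSubmodule.Quotient.mk_bracket, ← LieSubmodule.Quotient.mk_bracket, hC, hC, hinv]
  have : LieAlgebra.IsSolvable (L ⧸ N) :=
    Function.Surjective.lieAlgebra_isSolvable
      (f := ({ N.toSubmodule.mkQ with map_lie' := rfl } : L →ₗ⁅K⁆ L ⧸ N)) hsurj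
  have hdim' : Module.finrank K (L ⧸ N) ≤ 6 :=
    (Submodule.finrank_quotient_le N.toSubmodule).trans hdim
  obtain ⟨D, hD⟩ := exists_derivation hCm hdim'
  let π : L →ₗ[K] L ⧸ N := N.toSubmodule.mkQ
  have hπ : ∀ x y : L, π ⁅x, y⁆ = ⁅π x, π y⁆ := fun x y => rfl
  -- The symmetrization of `C (D ·) ·` is `C`, because `D + D^* = id`; its pullback is `φ`.
  let f : L →ₗ[K] Module.Dual K L := (C.compl₂ π).comp ((D : L ⧸ N →ₗ[K] L ⧸ N).comp π)
  have hf : ∀ x y, f x y = C (D (π x)) (π y) := fun x y => rfl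
  refine ⟨⟨f, fun x y => ?_⟩, fun x y => ?_⟩
  · ext z
    rw [LinearMap.sub_apply, Module.Dual.lie_apply, Module.Dual.lie_apply, hf, hf, hf]
    simp only [hπ, LieDerivation.apply_lie_eq_sub, map_sub, LinearMap.sub_apply]
    rw [hCm.inv_left, hCm.inv_left]
  · change φ x y = f x y + f y x
    rw [hf, hf, hCs (D (π y)), hD]
    rfl

/-- Every ad-invariant metric on a `T^*`-solitary Lie algebra is solitary. -/
theorem IsTStarSolitary.isSolitary {K L : Type*} [Field K] [LieRing L] [LieAlgebra K L]
    [FiniteDimensional K L] (h : IsTStarSolitary K L) {B : LinearMap.BilinForm K L}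
    (hB : IsAdInvariantMetric B) : IsSolitary B := by
  intro φ hφ hsa
  obtain ⟨D, hD⟩ := h (B.comp φ LinearMap.id) (fun x y => by
      ext z
      rw [Module.Dual.lie_apply]
      change B (φ ⁅x, y⁆) z = - B (φ y) ⁅x, z⁆
      rw [hφ, hB.inv_left]) (fun x y => by
      change B (φ x) y = B (φ y) x
      rw [hsa, hB.symm])
  let e := B.toDual hB.nondegenerate
  let f : L →ₗ[K] L := e.symm.toLinearMap.comp (D : L →ₗ[K] Module.Dual K L)
  have hf : ∀ x y, B (f x) y = D x y := fun x y =>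
    LinearMap.BilinForm.apply_toDual_symm_apply (hB := hB.nondegenerate) (D x) y
  let f' : L →ₗ[K] L := φ - f
  have hf' : ∀ x y, B (f' x) y = D y x := fun x y => by
    have : B (φ x) y = D x y + D y x := hD x y
    change B (φ x - f x) y = _
    rw [map_sub, LinearMap.sub_apply, hf, this]
    ring
  refine ⟨⟨f, fun x y => hB.eq_of fun z => ?_⟩, f', fun x y => ?_, ?_⟩
  · rw [map_sub, LinearMap.sub_apply, hB.inv_left, hB.inv_left, hf, hf, hf,
      LieDerivation.apply_lie_eq_sub, LinearMap.sub_apply, Module.Dual.lie_apply,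
      Module.Dual.lie_apply]
  · rw [hB.symm x, hf']
    exact hf x y
  · change φ = f + (φ - f)
    abel

end TStar

/-! ### Witt-type extension of isometries -/

section Witt

variable {K E : Type*} [Field K] [AddCommGroup E] [Module K E] [FiniteDimensional K E]
variable {B B' : LinearMap.BilinForm K E}

theorem exists_orthogonal_projection (U : Submodule K E) (hU : (B.restrict U).Nondegenerate) :
    ∃ P : E →ₗ[K] U, ∀ x, ∀ u ∈ U, B (P x) u = B x u := by
  refine ⟨((B.restrict U).toDual hU).symm.toLinearMap ∘ₗ U.subtype.dualMap ∘ₗ B,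
    fun x u hu => ?_⟩
  exact LinearMap.BilinForm.apply_toDual_symm_apply (B := B.restrict U) (hB := hU)
    (U.subtype.dualMap (B x)) ⟨u, hu⟩

theorem mem_of_orthogonal_orthogonal (hs : B.IsSymm) (hB : B.Nondegenerate) {G : Submodule K E}
    {x : E} (hx : ∀ z, (∀ g ∈ G, B z g = 0) → B z x = 0) : x ∈ G := by
  rw [← LinearMap.BilinForm.orthogonal_orthogonal hB hs.isRefl G]
  rw [LinearMap.BilinForm.mem_orthogonal_iff]
  intro z hz
  refine hx z fun g hg => ?_
  rw [hs.eq]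
  exact hz g hg

/-- A complement in `G^⊥` of the radical of `G^⊥` is nondegenerate. -/
theorem restrict_nondegenerate_of_complement (hs : B.IsSymm) (hB : B.Nondegenerate)
    {G U : Submodule K E} (hUG : ∀ u ∈ U, ∀ g ∈ G, B u g = 0) (hd : Disjoint U G)
    (hZ : ∀ z, (∀ g ∈ G, B z g = 0) → ∃ u ∈ U, ∃ g ∈ G, z = u + g) :
    (B.restrict U).Nondegenerate := by
  refine B.nondegenerate_restrict_of_disjoint_orthogonal hs.isRefl ?_
  rw [Submodule.disjoint_def] at hd ⊢
  intro x hx hx'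
  refine hd x hx (mem_of_orthogonal_orthogonal hs hB fun z hz => ?_)
  obtain ⟨u, hu, g, hg, rfl⟩ := hZ z hz
  rw [map_add, LinearMap.add_apply, hx' u hu, hs.eq, hUG x hx g hg, add_zero]

/-- Two forms that agree on `G + G^⊥` differ by an isometry fixing `G`. -/
theorem exists_isometry_of_agree [CharZero K] (hs : B.IsSymm) (hB : B.Nondegenerate)
    (hs' : B'.IsSymm) {G : Submodule K E} (hG : ∀ g ∈ G, B g = B' g)
    (hZ : ∀ z, (∀ g ∈ G, B z g = 0) → B z = B' z) :
    ∃ ψ : E ≃ₗ[K] E, (∀ g ∈ G, ψ g = g) ∧ ∀ x y, B' x y = B (ψ x) (ψ y) := by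
  -- As `B' - B` vanishes on `G` and `G^⊥`, `M` kills `G` and maps into `G^⊥⊥ = G`. So `B (M x) (M
  -- y) = 0`, and the two cross terms of `id + M` contribute half of `B' - B` each.
  let M : E →ₗ[K] E := (B.toDual hB).symm.toLinearMap ∘ₗ ((2 : K)⁻¹ • (B' - B))
  have hM : ∀ x y, B (M x) y = 2⁻¹ * (B' x y - B x y) := fun x y =>
    LinearMap.BilinForm.apply_toDual_symm_apply (hB := hB) (((2 : K)⁻¹ • (B' - B)) x) y
  have hMG : ∀ x, M x ∈ G := fun x => mem_of_orthogonal_orthogonal hs hB fun z hz => by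
    rw [hs.eq, hM, hs.eq, hs'.eq, hZ z hz, sub_self, mul_zero]
  have hMfix : ∀ g ∈ G, M g = 0 := fun g hg => hB.1 _ fun y => by
    rw [hM, hG g hg, sub_self, mul_zero]
  have hMM : ∀ x y, B (M x) (M y) = 0 := fun x y => by
    rw [hM, hs.eq, hs'.eq, hG _ (hMG y), sub_self, mul_zero]
  let ψ : E →ₗ[K] E := LinearMap.id + M
  have hψ : ∀ x, ψ x = x + M x := fun x => rfl
  have hfix : ∀ g ∈ G, ψ g = g := fun g hg => by rw [hψ, hMfix g hg, add_zero]
  have hinj : Function.Injective ψ := by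
    rw [← LinearMap.ker_eq_bot, LinearMap.ker_eq_bot']
    intro x hx
    have hxG : x ∈ G := by
      rw [eq_neg_of_add_eq_zero_left (a := x) (b := M x) hx]
      exact neg_mem (hMG x)
    rw [← hfix x hxG, hx]
  refine ⟨LinearEquiv.ofInjectiveEndo ψ hinj, hfix, fun x y => ?_⟩
  change B' x y = B (ψ x) (ψ y)
  rw [hψ, hψ, map_add, map_add, LinearMap.add_apply, LinearMap.add_apply, hMM, hM,
    hs.eq x (M y), hM, hs.eq y x, hs'.eq y x]
  field_simp
  ring

/-- A case of Witt's extension theorem: two forms that agree on `G × E` differ by an isometry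
fixing `G` as soon as they are isometric on a complement in `G^⊥` of the radical of `G^⊥`. -/
theorem exists_isometry_of_agree_left [CharZero K] (hs : B.IsSymm) (hB : B.Nondegenerate)
    (hs' : B'.IsSymm) (hB' : B'.Nondegenerate) {G U : Submodule K E}
    (hG : ∀ g ∈ G, B g = B' g) (hUG : ∀ u ∈ U, ∀ g ∈ G, B u g = 0) (hd : Disjoint U G)
    (hZ : ∀ z, (∀ g ∈ G, B z g = 0) → ∃ u ∈ U, ∃ g ∈ G, z = u + g)
    (η : U →ₗ[K] U) (hη : ∀ u v, B' (η u) (η v) = B u v) :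
    ∃ ψ : E ≃ₗ[K] E, (∀ g ∈ G, ψ g = g) ∧ ∀ x y, B' x y = B (ψ x) (ψ y) := by
  have hGr : ∀ x, ∀ g ∈ G, B' x g = B x g := fun x g hg => by
    rw [hs'.eq, ← hG g hg, hs.eq]
  have hUG' : ∀ u ∈ U, ∀ g ∈ G, B' u g = 0 := fun u hu g hg => by rw [hGr u g hg, hUG u hu g hg]
  have hU := restrict_nondegenerate_of_complement hs hB hUG hd hZ
  have hU' := restrict_nondegenerate_of_complement hs' hB' hUG' hd fun z hz =>
    hZ z fun g hg => by rw [← hGr z g hg, hz g hg]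
  obtain ⟨P, hP⟩ := exists_orthogonal_projection U hU
  obtain ⟨P', hP'⟩ := exists_orthogonal_projection U hU'
  have hPG : ∀ g ∈ G, P g = 0 := fun g hg => hU.1 _ fun u => by
    change B (P g) u = 0
    rw [hP g u u.2, hs.eq, hUG u u.2 g hg]
  have hPG' : ∀ g ∈ G, P' g = 0 := fun g hg => hU'.1 _ fun u => by
    change B' (P' g) u = 0
    rw [hP' g u u.2, hs'.eq, hUG' u u.2 g hg]
  have hPU : ∀ u : U, P u = u := fun u => by
    rw [← sub_eq_zero]
    refine hU.1 _ fun v => ?_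
    change B ((P u : E) - u) v = 0
    rw [map_sub, LinearMap.sub_apply, hP u v v.2, sub_self]
  let Q : E →ₗ[K] E := LinearMap.id - U.subtype ∘ₗ P
  have hQ : ∀ x, Q x = x - P x := fun x => rfl
  -- `ρ` is `η` on `U` and sends the `B`-complement of `U` into its `B'`-complement by `1 - P'`.
  -- Pulling `B'` back along `ρ` thus gives a form agreeing with `B` on `U + G`, which contains
  -- `G^⊥`.
  let ρ : E →ₗ[K] E := U.subtype ∘ₗ η ∘ₗ P + Q - U.subtype ∘ₗ P' ∘ₗ Q
  have hρ : ∀ x, ρ x = η (P x) + Q x - P' (Q x) := fun x => rfl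
  have hρG : ∀ g ∈ G, ρ g = g := fun g hg => by
    simp [hρ, hQ, hPG g hg, hPG' g hg]
  have hρU : ∀ u : U, ρ u = η u := fun u => by simp [hρ, hQ, hPU]
  let C : LinearMap.BilinForm K E := B'.comp ρ ρ
  have hC : ∀ x y, C x y = B' (ρ x) (ρ y) := fun x y => rfl
  have hCG : ∀ g ∈ G, B g = C g := fun g hg => by
    ext y
    have hU0 : ∀ u ∈ U, B g u = 0 := fun u hu => by rw [hs.eq, hUG u hu g hg]
    rw [hC, hρG g hg, ← hG g hg, hρ, hQ]
    simp only [map_add, map_sub, hU0 _ (SetLike.coe_mem _), zero_add, sub_zero]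
  have hCU : ∀ u : U, B u = C u := fun u => by
    ext y
    rw [hC, hρU, hρ, map_sub, map_add, hη, hs'.eq _ (P' _ : E), hP' _ _ (η u).2, hs'.eq (Q y),
      add_sub_cancel_right, hs.eq u (P y), hP y u u.2, hs.eq]
  obtain ⟨ψ, hψG, hψ⟩ := exists_isometry_of_agree (B' := C) hs hB
    ⟨fun x y => by rw [hC, hC, hs'.eq]⟩ hCG (fun z hz => by
      obtain ⟨u, hu, g, hg, rfl⟩ := hZ z hz
      rw [map_add, map_add, hCG g hg, hCU ⟨u, hu⟩])
  have hinj : Function.Injective ρ := by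
    rw [← LinearMap.ker_eq_bot, LinearMap.ker_eq_bot']
    intro x hx
    refine (LinearEquiv.map_eq_zero_iff ψ).mp (hB.1 _ fun y => ?_)
    rw [← ψ.apply_symm_apply y, ← hψ, hC, hx, map_zero, LinearMap.zero_apply]
  let r : E ≃ₗ[K] E := LinearEquiv.ofInjectiveEndo ρ hinj
  have hr : ∀ x, r x = ρ x := fun x => rfl
  refine ⟨r.symm.trans ψ, fun g hg => ?_, fun x y => ?_⟩
  · have : r.symm g = g := by rw [LinearEquiv.symm_apply_eq, hr, hρG g hg]
    rw [LinearEquiv.trans_apply, this, hψG g hg]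
  · rw [LinearEquiv.trans_apply, LinearEquiv.trans_apply, ← hψ, hC, ← hr, ← hr,
      r.apply_symm_apply, r.apply_symm_apply]

/-- Forms with orthogonal bases whose squared lengths are proportional by squares are isometric. -/
theorem exists_isometry_of_orthogonal {ι V : Type*} [Finite ι] [AddCommGroup V] [Module K V]
    {C C' : LinearMap.BilinForm K V} (v : Module.Basis ι K V) (w : ι → V)
    (hv : ∀ i j, i ≠ j → C (v i) (v j) = 0) (hw : ∀ i j, i ≠ j → C' (w i) (w j) = 0) (t : ι → K)
    (ht : ∀ i, t i ^ 2 * C' (w i) (w i) = C (v i) (v i)) :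
    ∃ η : V →ₗ[K] V, ∀ x y, C' (η x) (η y) = C x y := by
  let η : V →ₗ[K] V := v.constr K fun i => t i • w i
  refine ⟨η, fun x y => ?_⟩
  have : C'.comp η η = C := by
    refine LinearMap.BilinForm.ext_basis v fun i j => ?_
    change C' (η (v i)) (η (v j)) = _
    rw [Module.Basis.constr_basis, Module.Basis.constr_basis, map_smul, map_smul,
      LinearMap.smul_apply, smul_eq_mul, smul_eq_mul]
    by_cases h : i = j
    · subst h
      rw [← ht i]
      ring
    · rw [hv i j h, hw i j h, mul_zero, mul_zero]
  rw [← this]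
  rfl

end Witt

/-! ### From isometries to automorphisms -/

section Uniqueness

variable {K L : Type*} [Field K] [LieRing L] [LieAlgebra K L]

theorem apply_derived_eq {B B' : LinearMap.BilinForm K L}
    (h : ∀ x y z : L, B ⁅x, y⁆ z = B' ⁅x, y⁆ z) :
    ∀ g ∈ Submodule.span K {m : L | ∃ x y : L, ⁅x, y⁆ = m}, B g = B' g := by
  intro g hg
  induction hg using Submodule.span_induction with
  | mem x hx => obtain ⟨u, v, rfl⟩ := hx; ext z; exact h u v z
  | zero => simp
  | add x y _ _ hx hy => rw [map_add, map_add, hx, hy]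
  | smul a x _ hx => rw [map_smul, map_smul, hx]

theorem apply_derived_eq_zero {B : LinearMap.BilinForm K L} {u : L}
    (h : ∀ x y : L, B u ⁅x, y⁆ = 0) :
    ∀ g ∈ Submodule.span K {m : L | ∃ x y : L, ⁅x, y⁆ = m}, B u g = 0 := by
  intro g hg
  induction hg using Submodule.span_induction with
  | mem x hx => obtain ⟨u, v, rfl⟩ := hx; exact h u v
  | zero => simp
  | add x y _ _ hx hy => rw [map_add, hx, hy, add_zero]
  | smul a x _ hx => rw [map_smul, hx, smul_zero]

/-- Two nondegenerate forms that agree on `⁅L, L⁆ × L` are related by an automorphism, provided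
that they are isometric on a complement `U` of the isotropic part of the center. -/
theorem exists_lieEquiv_of_agree [CharZero K] [FiniteDimensional K L]
    {B B' : LinearMap.BilinForm K L} (hs : B.IsSymm) (hB : B.Nondegenerate)
    (hs' : B'.IsSymm) (hB' : B'.Nondegenerate)
    (hag : ∀ x y z : L, B ⁅x, y⁆ z = B' ⁅x, y⁆ z)
    (hcent : ∀ z : L, (∀ x y : L, B z ⁅x, y⁆ = 0) → ∀ x : L, ⁅z, x⁆ = 0) {U : Submodule K L}
    (hUG : ∀ u ∈ U, ∀ x y : L, B u ⁅x, y⁆ = 0)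
    (hd : Disjoint U (Submodule.span K {m : L | ∃ x y : L, ⁅x, y⁆ = m}))
    (hZ : ∀ z : L, (∀ x : L, ⁅z, x⁆ = 0) →
      ∃ u ∈ U, ∃ g ∈ Submodule.span K {m : L | ∃ x y : L, ⁅x, y⁆ = m}, z = u + g)
    (η : U →ₗ[K] U) (hη : ∀ u v, B' (η u) (η v) = B u v) :
    ∃ ψ : L ≃ₗ⁅K⁆ L, ∀ x y, B' x y = B (ψ x) (ψ y) := by
  have hmem : ∀ x y : L, ⁅x, y⁆ ∈ Submodule.span K {m : L | ∃ x y : L, ⁅x, y⁆ = m} :=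
    fun x y => Submodule.subset_span ⟨x, y, rfl⟩
  obtain ⟨ψ, hψG, hψ⟩ := exists_isometry_of_agree_left hs hB hs' hB' (apply_derived_eq hag)
    (fun u hu => apply_derived_eq_zero (hUG u hu)) hd
    (fun z hz => hZ z (hcent z fun x y => hz _ (hmem x y))) η hη
  -- An isometry fixing the derived algebra moves vectors only within its orthogonal complement,
  -- which is central.
  have hψZ : ∀ x y : L, ⁅ψ x - x, y⁆ = 0 := fun x => hcent _ fun u v => by
    have h1 : B' x ⁅u, v⁆ = B (ψ x) ⁅u, v⁆ := by rw [hψ, hψG _ (hmem u v)]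
    rw [map_sub, LinearMap.sub_apply, ← h1, hs'.eq, ← hag, hs.eq, sub_self]
  have hl : ∀ x y : L, ⁅ψ x, y⁆ = ⁅x, y⁆ := fun x y => by
    rw [← sub_eq_zero, ← sub_lie, hψZ]
  refine ⟨{ ψ with map_lie' := ?_ }, hψ⟩
  intro x y
  change ψ ⁅x, y⁆ = ⁅ψ x, ψ y⁆
  rw [hψG _ (hmem x y), hl, ← lie_skew x (ψ y), hl, lie_skew]

end Uniqueness

/-! ### Scaling automorphisms and proportional metrics -/

section Scaling

variable {K L : Type*} [Field K] [LieRing L] [LieAlgebra K L]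

/-- Pulling back an ad-invariant metric along an automorphism. -/
theorem IsAdInvariantMetric.pullback {B : LinearMap.BilinForm K L} (hB : IsAdInvariantMetric B)
    (ψ : L ≃ₗ⁅K⁆ L) :
    IsAdInvariantMetric (B.comp (ψ.toLinearEquiv : L →ₗ[K] L) (ψ.toLinearEquiv : L →ₗ[K] L)) := by
  refine ⟨⟨fun x y => hB.symm _ _⟩, ⟨fun x hx => ?_, fun x hx => ?_⟩, fun x y z => ?_⟩
  · have : ψ x = 0 := hB.nondegenerate.1 _ fun y => by
      rw [← ψ.apply_symm_apply y]; exact hx (ψ.symm y)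
    rw [← ψ.symm_apply_apply x, this, map_zero]
  · have : ψ x = 0 := hB.nondegenerate.2 _ fun y => by
      rw [← ψ.apply_symm_apply y]; exact hx (ψ.symm y)
    rw [← ψ.symm_apply_apply x, this, map_zero]
  · change B (ψ ⁅x, y⁆) (ψ z) = - B (ψ y) (ψ ⁅x, z⁆)
    rw [LieEquiv.map_lie, LieEquiv.map_lie, hB.inv_left]

variable {B B' : LinearMap.BilinForm K L} {c d : L}

/-- Double extensions of abelian metric Lie algebras by a line have automorphisms that scale the
metric by any nonzero square. -/
theorem IsAbelianDoubleExtension.exists_scaling [FiniteDimensional K L]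
    (h : IsAbelianDoubleExtension B c d) (hB : IsAdInvariantMetric B) {l : K} (hl : l ≠ 0) :
    ∃ ψ : L ≃ₗ⁅K⁆ L, ∀ x y, B (ψ x) (ψ y) = l ^ 2 * B x y := by
  have hcr : ∀ x : L, ⁅x, c⁆ = 0 := fun x => by rw [← lie_skew, h.central, neg_zero]
  have hcl : ∀ x y : L, B c ⁅x, y⁆ = 0 := fun x y => by
    rw [← hB.lie_left, h.central, map_zero, LinearMap.zero_apply]
  -- Eigenvalues `l^2` on `c`, 1 on `d`, and `l` on the orthogonal complement of both.
  let f : L →ₗ[K] L := l • LinearMap.id + (l ^ 2 - l) • (B d).smulRight c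
    + (1 - l) • (B c).smulRight d
  have hf : ∀ x, f x = l • x + (l ^ 2 - l) • (B d x • c) + (1 - l) • (B c x • d) := fun x => rfl
  have hsc : ∀ x y, B (f x) (f y) = l ^ 2 * B x y := fun x y => by
    rw [hf, hf]
    simp only [map_add, map_smul, LinearMap.add_apply, LinearMap.smul_apply, smul_eq_mul,
      h.self_left, h.self_right, h.pairing, hB.symm d c, hB.symm x c, hB.symm x d]
    ring
  have hinj : Function.Injective f := by
    rw [← LinearMap.ker_eq_bot, LinearMap.ker_eq_bot']
    intro x hx
    refine hB.eq_zero fun y => ?_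
    have := hsc x y
    rw [hx, map_zero, LinearMap.zero_apply] at this
    exact (mul_eq_zero.mp this.symm).resolve_left (pow_ne_zero 2 hl)
  refine ⟨{ LinearEquiv.ofInjectiveEndo f hinj with map_lie' := ?_ }, hsc⟩
  intro x y
  change f ⁅x, y⁆ = ⁅f x, f y⁆
  have hb : B d ⁅x, y⁆ • c = ⁅x, y⁆ - B c x • ⁅d, y⁆ + B c y • ⁅d, x⁆ := by
    have := h.bracket x y
    rw [hB.symm] at this
    nth_rewrite 2 [this]
    abel
  rw [hf, hf, hf, hcl, hb]
  simp only [lie_add, add_lie, lie_smul, smul_lie, h.central, hcr, lie_self, ← lie_skew d x]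
  module

/-- On a nonabelian double extension of an abelian metric Lie algebra by a line, any two
ad-invariant metrics are proportional on `⁅L, L⁆ × L`. -/
theorem IsAbelianDoubleExtension.exists_proportional [FiniteDimensional K L]
    (h : IsAbelianDoubleExtension B c d) (hB : IsAdInvariantMetric B)
    (hB' : IsAdInvariantMetric B') (hna : ∃ x y : L, ⁅x, y⁆ ≠ 0) :
    ∃ a : K, a ≠ 0 ∧ ∀ x y z : L, B' ⁅x, y⁆ z = a * B ⁅x, y⁆ z := by
  have hcc := h.self_left
  have hbr : ∀ v w : L, B c v = 0 → B c w = 0 → ⁅v, w⁆ = B ⁅v, w⁆ d • c := fun v w hv hw => by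
    have := h.bracket v w
    rwa [hv, hw, zero_smul, zero_smul, add_zero, sub_zero] at this
  have hp : ∀ x, B c (x - B c x • d) = 0 := fun x => by simp [h.pairing]
  have hdec : ∀ x y : L, ⁅x, y⁆ = ⁅x - B c x • d, y - B c y • d⁆ + B c x • ⁅d, y - B c y • d⁆
      - B c y • ⁅d, x - B c x • d⁆ := fun x y => by
    simp only [lie_sub, sub_lie, lie_smul, smul_lie, lie_self, ← lie_skew d x]
    module
  have hzd : ∀ z : L, z = (z - B c z • d) + B c z • d := fun z => by abel
  obtain ⟨v, w, hv, hw, hvw⟩ : ∃ v w : L, B c v = 0 ∧ B c w = 0 ∧ B ⁅v, w⁆ d ≠ 0 := by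
    by_contra hcon
    push Not at hcon
    have h0 : ∀ v w : L, B c v = 0 → B c w = 0 → ⁅v, w⁆ = 0 := fun v w hv hw => by
      rw [hbr v w hv hw, hcon v w hv hw, zero_smul]
    have h1 : ∀ w : L, B c w = 0 → ⁅d, w⁆ = 0 := fun w hw => hB.eq_zero fun z => by
      rw [hzd z, map_add, map_smul, hB.lie_self_left, smul_zero, add_zero, hB.lie_left,
        h0 w _ hw (hp z), map_zero]
    obtain ⟨x, y, hxy⟩ := hna
    apply hxy
    rw [hdec, h0 _ _ (hp x) (hp y), h1 _ (hp y), h1 _ (hp x)]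
    simp
  let φ : L →ₗ[K] L := (B.toDual hB.nondegenerate).symm.toLinearMap ∘ₗ B'
  have hφ : ∀ x y, B (φ x) y = B' x y := fun x y =>
    LinearMap.BilinForm.apply_toDual_symm_apply (hB := hB.nondegenerate) (B' x) y
  have hφl : ∀ x y : L, φ ⁅x, y⁆ = ⁅φ x, y⁆ := fun x y => hB.eq_of fun z => by
    rw [hφ, hB'.lie_left, hB.lie_left, hφ]
  -- If `φ u` had a `d`-component, comparing `φ ⁅u, x⁆` with `⁅φ u, x⁆` would express `B ⁅x, y⁆ d`
  -- through `B ⁅u, x⁆ d`. Taking `x = u` kills the latter, hence the former, against the choice of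
  -- `v, w`. So `φ` preserves `c^⊥`, and `c` is an eigenvector whose eigenvalue is the factor
  -- sought.
  have hφh : ∀ u, B c u = 0 → B c (φ u) = 0 := by
    intro u hu
    by_contra hs
    have key : ∀ x y : L, B c x = 0 → B c y = 0 →
        B c (φ u) * B ⁅x, y⁆ d = B ⁅u, x⁆ d * B (φ c) y := by
      intro x y hx hy
      have h1 := congrArg (fun t => B (φ t) y) (hbr u x hu hx)
      have h2 := congrArg (fun t => B t y) (h.bracket (φ u) x)
      simp only [map_smul, map_add, map_sub, LinearMap.add_apply, LinearMap.sub_apply,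
        LinearMap.smul_apply, smul_eq_mul, hx, hy, mul_zero, zero_add, zero_mul, sub_zero] at h1 h2
      rw [hφl, h2, hB.rot] at h1
      exact h1
    have hu0 : ∀ y, B c y = 0 → B ⁅u, y⁆ d = 0 := fun y hy => by
      have := key u y hu hy
      rw [lie_self, map_zero, LinearMap.zero_apply, zero_mul] at this
      exact (mul_eq_zero.mp this).resolve_left hs
    have := key v w hv hw
    rw [hu0 v hv, zero_mul] at this
    exact (mul_ne_zero hs hvw) this
  have hφc : φ c = B (φ c) d • c := hB.exists_smul_of_orthogonal h.pairing fun y hy => by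
    rw [hφ, hB'.symm, ← hφ, hB.symm, hφh y hy]
  have hBc : ∀ z, B' c z = B (φ c) d * B c z := fun z => by
    rw [← hφ]
    nth_rewrite 1 [hφc]
    rw [map_smul, LinearMap.smul_apply, smul_eq_mul]
  refine ⟨B (φ c) d, fun ha => ?_, ?_⟩
  · have : c = 0 := hB'.eq_zero fun y => by rw [hBc, ha, zero_mul]
    have hcd := h.pairing
    rw [this, map_zero, LinearMap.zero_apply] at hcd
    exact zero_ne_one hcd
  · have k1 : ∀ v w z : L, B c v = 0 → B c w = 0 → B' ⁅v, w⁆ z = B (φ c) d * B ⁅v, w⁆ z := by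
      intro v w z hv hw
      rw [hbr v w hv hw]
      simp only [map_smul, LinearMap.smul_apply, smul_eq_mul, hBc]
      ring
    have k2 : ∀ w z : L, B c w = 0 → B' ⁅d, w⁆ z = B (φ c) d * B ⁅d, w⁆ z := by
      intro w z hw
      rw [hzd z, map_add, map_add, map_smul, map_smul, hB.lie_self_left, hB'.lie_self_left,
        smul_zero, add_zero, add_zero, hB.rot, hB'.rot, k1 _ _ _ hw (hp z)]
    intro x y z
    rw [hdec x y]
    simp only [map_add, map_sub, map_smul, LinearMap.add_apply, LinearMap.sub_apply,
      LinearMap.smul_apply, smul_eq_mul, k1 _ _ z (hp x) (hp y), k2 _ z (hp x), k2 _ z (hp y)]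
    ring

/-- Two ad-invariant metrics are, up to automorphism, proportional on `⁅L, L⁆ × L`, where the
factor of proportionality matters only modulo squares. -/
theorem exists_normalization [CharZero K] [FiniteDimensional K L] [LieAlgebra.IsSolvable L]
    (hdim : Module.finrank K L ≤ 6) (hB : IsAdInvariantMetric B) (hB' : IsAdInvariantMetric B') :
    ∃ a : K, a ≠ 0 ∧ ∀ s l : K, l ≠ 0 → a = s * l ^ 2 →
      ∃ ψ : L ≃ₗ⁅K⁆ L, ∀ x y z : L, B' (ψ ⁅x, y⁆) (ψ z) = s * B ⁅x, y⁆ z := by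
  by_cases hna : ∃ x y : L, ⁅x, y⁆ ≠ 0
  · obtain ⟨c, d, h⟩ := exists_isAbelianDoubleExtension hB hdim hna
    obtain ⟨a, ha, hprop⟩ := h.exists_proportional hB hB' hna
    refine ⟨a, ha, fun s l hl hsl => ?_⟩
    obtain ⟨ψ, hψ⟩ := h.exists_scaling hB (inv_ne_zero hl)
    refine ⟨ψ, fun x y z => ?_⟩
    rw [LieEquiv.map_lie, hprop, ← LieEquiv.map_lie, hψ, hsl]
    field_simp
  · push Not at hna
    exact ⟨1, one_ne_zero, fun s l _ _ => ⟨LieEquiv.refl, fun x y z => by simp [hna]⟩⟩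

end Scaling

/-! ### Uniqueness over `ℂ` -/

section Complex

variable {L : Type*} [LieRing L] [LieAlgebra ℂ L] [FiniteDimensional ℂ L]
  [LieAlgebra.IsSolvable L] {B B' : LinearMap.BilinForm ℂ L}

/-- Both forms diagonalize, and every ratio of squared lengths is a complex square. -/
theorem exists_isometry_complex {V : Type*} [AddCommGroup V] [Module ℂ V] [FiniteDimensional ℂ V]
    {C C' : LinearMap.BilinForm ℂ V} (hs : C.IsSymm) (hs' : C'.IsSymm) (hC' : C'.Nondegenerate) :
    ∃ η : V →ₗ[ℂ] V, ∀ x y, C' (η x) (η y) = C x y := by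
  have : Invertible (2 : ℂ) := invertibleOfNonzero two_ne_zero
  obtain ⟨v, hv⟩ := LinearMap.BilinForm.exists_orthogonal_basis (B := C) ⟨hs.eq⟩
  obtain ⟨w, hw⟩ := LinearMap.BilinForm.exists_orthogonal_basis (B := C') ⟨hs'.eq⟩
  have hne : ∀ i, C' (w i) (w i) ≠ 0 :=
    LinearMap.IsOrthoᵢ.not_isOrtho_basis_self_of_separatingLeft hw hC'.1
  choose t ht using fun i => IsAlgClosed.exists_pow_nat_eq (C (v i) (v i) / C' (w i) (w i))
    (n := 2) two_pos
  exact exists_isometry_of_orthogonal v w (fun i j hij => hv hij) (fun i j hij => hw hij) t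
    fun i => by rw [ht, div_mul_cancel₀ _ (hne i)]

theorem IsAdInvariantMetric.lie_eq_zero {K L : Type*} [Field K] [LieRing L] [LieAlgebra K L]
    {B : LinearMap.BilinForm K L} (hB : IsAdInvariantMetric B)
    {z : L} (hz : ∀ x y : L, B z ⁅x, y⁆ = 0) (x : L) : ⁅z, x⁆ = 0 :=
  hB.eq_zero fun y => by rw [hB.lie_left, hz]

/-- Over `ℂ`, ad-invariant metrics on solvable Lie algebras of dimension at most six are unique
up to automorphism. -/
theorem exists_lieEquiv_complex (hdim : Module.finrank ℂ L ≤ 6) (hB : IsAdInvariantMetric B)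
    (hB' : IsAdInvariantMetric B') :
    ∃ ψ : L ≃ₗ⁅ℂ⁆ L, ∀ x y : L, B' x y = B (ψ x) (ψ y) := by
  obtain ⟨a, ha, hnorm⟩ := exists_normalization hdim hB hB'
  obtain ⟨l, hl⟩ := IsAlgClosed.exists_pow_nat_eq a (n := 2) two_pos
  have hl0 : l ≠ 0 := by
    rintro rfl
    exact ha (by rw [← hl]; simp)
  obtain ⟨ψ, hψ⟩ := hnorm 1 l hl0 (by rw [hl, one_mul])
  let C := B'.comp (ψ.toLinearEquiv : L →ₗ[ℂ] L) (ψ.toLinearEquiv : L →ₗ[ℂ] L)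
  have hC : IsAdInvariantMetric C := hB'.pullback ψ
  have hCB : ∀ x y z : L, B ⁅x, y⁆ z = C ⁅x, y⁆ z := fun x y z => by
    have := hψ x y z
    rw [one_mul] at this
    exact this.symm
  let G : Submodule ℂ L := Submodule.span ℂ {m : L | ∃ x y : L, ⁅x, y⁆ = m}
  let Z : Submodule ℂ L := (LieAlgebra.center ℂ L).toSubmodule
  have hZ : ∀ z, z ∈ Z ↔ ∀ x : L, ⁅z, x⁆ = 0 := fun z => by
    change z ∈ LieAlgebra.center ℂ L ↔ _
    rw [LieModule.mem_maxTrivSubmodule]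
    refine forall_congr' fun x => ?_
    rw [← lie_skew, neg_eq_zero]
  -- Any complement of `Z ⊓ G` in the center serves here.
  obtain ⟨Q, hQ⟩ := exists_isCompl (Z ⊓ G)
  have hUZ : ∀ u ∈ Q ⊓ Z, ∀ x y : L, B u ⁅x, y⁆ = 0 := fun u hu x y => by
    rw [← hB.lie_left, (hZ u).mp hu.2, map_zero, LinearMap.zero_apply]
  have hd : Disjoint (Q ⊓ Z) G := by
    rw [Submodule.disjoint_def]
    rintro x ⟨hxQ, hxZ⟩ hxG
    exact Submodule.disjoint_def.mp hQ.disjoint x ⟨hxZ, hxG⟩ hxQ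
  have hdec : ∀ z : L, (∀ x : L, ⁅z, x⁆ = 0) → ∃ u ∈ Q ⊓ Z, ∃ g ∈ G, z = u + g := by
    intro z hz
    have hz' := (hZ z).mpr hz
    obtain ⟨r, hr, q, hq, rfl⟩ := Submodule.mem_sup.mp
      (hQ.sup_eq_top ▸ Submodule.mem_top : z ∈ (Z ⊓ G) ⊔ Q)
    exact ⟨q, ⟨hq, by simpa using Z.sub_mem hz' hr.1⟩, r, hr.2, add_comm _ _⟩
  have hCU : (C.restrict (Q ⊓ Z)).Nondegenerate := by
    refine restrict_nondegenerate_of_complement hC.isSymm hC.nondegenerate (G := G) ?_ hd ?_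
    · intro u hu
      refine apply_derived_eq_zero fun x y => ?_
      rw [hC.symm, ← hCB, hB.symm, hUZ u hu]
    · intro z hz
      exact hdec z (hC.lie_eq_zero fun x y => hz _ (Submodule.subset_span ⟨x, y, rfl⟩))
  obtain ⟨η, hη⟩ := exists_isometry_complex (C := B.restrict (Q ⊓ Z)) (C' := C.restrict (Q ⊓ Z))
    ⟨fun x y => hB.symm _ _⟩ ⟨fun x y => hC.symm _ _⟩ hCU
  obtain ⟨χ, hχ⟩ := exists_lieEquiv_of_agree hB.isSymm hB.nondegenerate hC.isSymm hC.nondegenerate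
    hCB (fun z hz => hB.lie_eq_zero hz) hUZ hd hdec η hη
  refine ⟨ψ.symm.trans χ, fun x y => ?_⟩
  rw [LieEquiv.trans_apply, LieEquiv.trans_apply, ← hχ]
  change _ = B' (ψ _) (ψ _)
  rw [ψ.apply_symm_apply, ψ.apply_symm_apply]

end Complex

/-! ### Orthogonal decompositions into ideals -/

section Decomposition

variable {K L : Type*} [Field K] [LieRing L] [LieAlgebra K L]
variable {B : LinearMap.BilinForm K L} {k : ℕ} {I : Fin k → LieIdeal K L}

/-- Indicator weights give the projections; weights `±1` give the operator relating `B` to its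
rescaling. -/
theorem exists_scalar_on_summands
    (hI : DirectSum.IsInternal fun i => (I i).toSubmodule) (ε : Fin k → K) :
    ∃ E : L →ₗ[K] L, ∀ i, ∀ x ∈ I i, E x = ε i • x := by
  let e := LinearEquiv.ofBijective (DirectSum.coeLinearMap fun i => (I i).toSubmodule) hI
  let F : (DirectSum (Fin k) fun i => (I i).toSubmodule) →ₗ[K] L :=
    DirectSum.toModule K (Fin k) L fun i => ε i • (I i).toSubmodule.subtype
  refine ⟨F ∘ₗ e.symm.toLinearMap, fun i x hx => ?_⟩
  have he : e (DirectSum.lof K (Fin k) (fun i => (I i).toSubmodule) i ⟨x, hx⟩) = x :=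
    DirectSum.coeLinearMap_lof _ _ _
  change F (e.symm x) = ε i • x
  nth_rewrite 1 [← he]
  rw [e.symm_apply_apply]
  exact DirectSum.toModule_lof K i _

theorem induction_on_summands {p : L → Prop}
    (hI : DirectSum.IsInternal fun i => (I i).toSubmodule) (h0 : p 0)
    (hadd : ∀ x y, p x → p y → p (x + y)) (hmem : ∀ i, ∀ x ∈ I i, p x) (x : L) : p x := by
  have hx : x ∈ ⨆ i, (I i).toSubmodule := by
    rw [hI.submodule_iSup_eq_top]
    exact Submodule.mem_top
  exact Submodule.iSup_induction _ (motive := p) hx hmem h0 hadd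

theorem lie_scalar_on_summands
    (hI : DirectSum.IsInternal fun i => (I i).toSubmodule) {ε : Fin k → K} {E : L →ₗ[K] L}
    (hE : ∀ i, ∀ x ∈ I i, E x = ε i • x) (x y : L) : E ⁅x, y⁆ = ⁅x, E y⁆ := by
  induction y using induction_on_summands hI with
  | h0 => simp
  | hadd y z hy hz => rw [lie_add, map_add, map_add, lie_add, hy, hz]
  | hmem i y hy => rw [hE i _ ((I i).lie_mem hy), hE i y hy, lie_smul]

theorem selfAdjoint_scalar_on_summands
    (hI : DirectSum.IsInternal fun i => (I i).toSubmodule) (ho : IsOrthogonalFamily B I)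
    {ε : Fin k → K} {E : L →ₗ[K] L} (hE : ∀ i, ∀ x ∈ I i, E x = ε i • x) (x y : L) :
    B (E x) y = B x (E y) := by
  induction x using induction_on_summands hI with
  | h0 => simp
  | hadd x z hx hz => simp only [map_add, LinearMap.add_apply, hx, hz]
  | hmem i x hx =>
    induction y using induction_on_summands hI with
    | h0 => simp
    | hadd y z hy hz => simp only [map_add, hy, hz]
    | hmem j y hy =>
      rw [hE i x hx, hE j y hy, map_smul, map_smul, LinearMap.smul_apply]
      by_cases h : i = j
      · rw [h]
      · rw [ho i j h x hx y hy, smul_zero, smul_zero]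

/-- An irreducible ideal with a non-isotropic central element is a line. -/
theorem eq_smul_of_central (hB : IsAdInvariantMetric B) {J : LieIdeal K L}
    (hJ : IsIrreducibleLie K J) {p : L} (hp : p ∈ J) (hc : ∀ x : L, ⁅p, x⁆ = 0)
    (hpp : B p p ≠ 0) : ∀ x ∈ J, ∃ a : K, x = a • p := by
  have hc' : ∀ x : L, ⁅x, p⁆ = 0 := fun x => by rw [← lie_skew, hc, neg_zero]
  let J₁ : LieIdeal K J :=
    { (Submodule.span K {p}).comap J.toSubmodule.subtype with
      lie_mem := by
        intro y x hx
        change (x : L) ∈ Submodule.span K {p} at hx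
        change ⁅(y : L), (x : L)⁆ ∈ Submodule.span K {p}
        obtain ⟨a, ha⟩ := Submodule.mem_span_singleton.mp hx
        have : ⁅(y : L), (x : L)⁆ = 0 := by rw [← ha, lie_smul, hc', smul_zero]
        rw [this]
        exact zero_mem _ }
  let J₂ : LieIdeal K J :=
    { (LinearMap.ker (B p)).comap J.toSubmodule.subtype with
      lie_mem := by
        intro y x _
        change B p ⁅(y : L), (x : L)⁆ = 0
        rw [← hB.lie_left, hc, map_zero, LinearMap.zero_apply] }
  have h1 : ∀ x : J, x ∈ J₁ ↔ ∃ a : K, a • p = x := fun x => Submodule.mem_span_singleton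
  have h2 : ∀ x : J, x ∈ J₂ ↔ B p x = 0 := fun x => Iff.rfl
  have hcompl : IsCompl J₁ J₂ := by
    constructor
    · rw [disjoint_iff, LieSubmodule.eq_bot_iff]
      intro x hx
      obtain ⟨hx1, hx2⟩ := LieSubmodule.mem_inf _ _ _ |>.mp hx
      obtain ⟨a, ha⟩ := (h1 x).mp hx1
      rw [h2, ← ha, map_smul, smul_eq_mul] at hx2
      have ha0 : a = 0 := (mul_eq_zero.mp hx2).resolve_right hpp
      ext
      rw [← ha, ha0, zero_smul]
      rfl
    · rw [codisjoint_iff, eq_top_iff]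
      intro x _
      rw [LieSubmodule.mem_sup]
      refine ⟨(B p x / B p p) • ⟨p, hp⟩, (h1 _).mpr ⟨_, rfl⟩, x - (B p x / B p p) • ⟨p, hp⟩,
        (h2 _).mpr ?_, by abel⟩
      change B p ((x : L) - (B p x / B p p) • p) = 0
      rw [map_sub, map_smul, smul_eq_mul, div_mul_cancel₀ _ hpp, sub_self]
  intro x hx
  rcases hJ J₁ J₂ hcompl with h | h
  · exfalso
    have : (⟨p, hp⟩ : J) ∈ J₁ := (h1 _).mpr ⟨1, one_smul _ _⟩
    rw [h, LieSubmodule.mem_bot] at this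
    have hp0 : p = 0 := congrArg Subtype.val this
    exact hpp (by rw [hp0, map_zero])
  · refine ⟨B p x / B p p, ?_⟩
    have : (⟨x, hx⟩ - (B p x / B p p) • ⟨p, hp⟩ : J) ∈ J₂ := (h2 _).mpr (by
      change B p (x - (B p x / B p p) • p) = 0
      rw [map_sub, map_smul, smul_eq_mul, div_mul_cancel₀ _ hpp, sub_self])
    rw [h, LieSubmodule.mem_bot] at this
    exact sub_eq_zero.mp (congrArg Subtype.val this)

/-- The projections onto the summands of a decomposition into orthogonal ideals. -/
theorem exists_projections (hI : DirectSum.IsInternal fun i => (I i).toSubmodule)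
    (ho : IsOrthogonalFamily B I) : ∃ π : Fin k → L →ₗ[K] L, (∀ i x, π i x ∈ I i) ∧
      (∀ i, ∀ x ∈ I i, π i x = x) ∧ (∀ x, ∑ i, π i x = x) ∧
      (∀ i, ∀ x y : L, π i ⁅x, y⁆ = ⁅x, π i y⁆) ∧ ∀ i x y, B (π i x) y = B x (π i y) := by
  choose π hπ using fun i => exists_scalar_on_summands hI (Pi.single i (1 : K))
  have hself : ∀ i, ∀ x ∈ I i, π i x = x := fun i x hx => by
    rw [hπ i i x hx, Pi.single_eq_same, one_smul]
  have hne : ∀ i j, j ≠ i → ∀ x ∈ I j, π i x = 0 := fun i j h x hx => by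
    rw [hπ i j x hx, Pi.single_eq_of_ne h, zero_smul]
  refine ⟨π, fun i x => ?_, hself, fun x => ?_, fun i => lie_scalar_on_summands hI (hπ i),
    fun i => selfAdjoint_scalar_on_summands hI ho (hπ i)⟩
  · induction x using induction_on_summands hI with
    | h0 => simp
    | hadd x y hx hy => rw [map_add]; exact add_mem hx hy
    | hmem j x hx =>
      by_cases h : j = i
      · subst h; rwa [hself j x hx]
      · rw [hne i j h x hx]; exact zero_mem _
  · induction x using induction_on_summands hI with
    | h0 => simp
    | hadd x y hx hy => simp only [map_add, Finset.sum_add_distrib, hx, hy]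
    | hmem j x hx =>
      rw [Finset.sum_eq_single j (fun i _ h => hne i j h.symm x hx) (by simp), hself j x hx]

/-- In a summand without non-isotropic central elements, the central elements lie in the derived
algebra. -/
theorem mem_derived_of_central [CharZero K] [FiniteDimensional K L] (hB : IsAdInvariantMetric B)
    (hI : DirectSum.IsInternal fun i => (I i).toSubmodule) (ho : IsOrthogonalFamily B I) {i : Fin k}
    (hi : ¬ ∃ p ∈ I i, (∀ x : L, ⁅p, x⁆ = 0) ∧ B p p ≠ 0) {z : L} (hz : z ∈ I i)
    (hc : ∀ x : L, ⁅z, x⁆ = 0) : z ∈ Submodule.span K {m : L | ∃ x y : L, ⁅x, y⁆ = m} := by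
  push Not at hi
  refine mem_of_orthogonal_orthogonal hB.isSymm hB.nondegenerate fun v hv => ?_
  have hvc : ∀ x : L, ⁅v, x⁆ = 0 :=
    hB.lie_eq_zero fun x y => hv _ (Submodule.subset_span ⟨x, y, rfl⟩)
  obtain ⟨π, hmem, hself, -, hlie, hadj⟩ := exists_projections hI ho
  have hπc : ∀ x : L, ⁅π i v, x⁆ = 0 := fun x => by
    rw [← lie_skew, ← hlie, ← lie_skew, hvc, neg_zero, map_zero, neg_zero]
  -- Polarization: central vectors of the summand are all isotropic, hence mutually orthogonal.
  have h1 := hi z hz hc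
  have h2 := hi _ (hmem i v) hπc
  have h3 := hi _ (add_mem hz (hmem i v)) fun x => by rw [add_lie, hc, hπc, add_zero]
  simp only [map_add, LinearMap.add_apply, h1, h2, hB.symm z (π i v)] at h3
  rw [← hself i z hz, ← hadj]
  have h4 : (2 : K) * B (π i v) z = 0 := by linear_combination h3
  exact (mul_eq_zero.mp h4).resolve_left two_ne_zero

end Decomposition

/-! ### Uniqueness over `ℝ` -/

section Real

theorem exists_sign_mul_sq {b c : ℝ} (hb : b ≠ 0) (hc : c ≠ 0) :
    ∃ e t : ℝ, (e = 1 ∨ e = -1) ∧ t ≠ 0 ∧ t ^ 2 * c = e * b := by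
  rcases lt_or_gt_of_ne (div_ne_zero hb hc) with h | h
  · refine ⟨-1, √(-(b / c)), Or.inr rfl, (Real.sqrt_pos.mpr (neg_pos.mpr h)).ne', ?_⟩
    rw [Real.sq_sqrt (neg_pos.mpr h).le, neg_mul, div_mul_cancel₀ _ hc, neg_one_mul]
  · refine ⟨1, √(b / c), Or.inl rfl, (Real.sqrt_pos.mpr h).ne', ?_⟩
    rw [Real.sq_sqrt h.le, div_mul_cancel₀ _ hc, one_mul]

variable {L : Type*} [LieRing L] [LieAlgebra ℝ L] [FiniteDimensional ℝ L]
  [LieAlgebra.IsSolvable L] {B B' : LinearMap.BilinForm ℝ L}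

/-- Over `ℝ`, ad-invariant metrics on solvable Lie algebras of dimension at most six are unique up
to automorphism and up to signs on the summands of an orthogonal irreducible decomposition. -/
theorem exists_lieEquiv_real (hdim : Module.finrank ℝ L ≤ 6) (hB : IsAdInvariantMetric B)
    {k : ℕ} {I : Fin k → LieIdeal ℝ L} (hI : IsOrthogonalIrreducibleDecomposition B I)
    (hB' : IsAdInvariantMetric B') :
    ∃ (ψ : L ≃ₗ⁅ℝ⁆ L) (ε : Fin k → ℝ) (h : LinearMap.BilinForm ℝ L),
      (∀ i, ε i = 1 ∨ ε i = -1) ∧ IsRescalingAlong B I ε h ∧ ∀ x y : L, B' x y = h (ψ x) (ψ y) := by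
  classical
  have hint := hI.isInternal
  have ho := hI.orthogonal
  obtain ⟨a, ha, hnorm⟩ := exists_normalization hdim hB hB'
  obtain ⟨s, l, hs, hl, hsl⟩ := exists_sign_mul_sq ha one_ne_zero
  have hss : s * s = 1 := by rcases hs with rfl | rfl <;> norm_num
  have hs0 : s ≠ 0 := left_ne_zero_of_mul_eq_one hss
  obtain ⟨ψ, hψ⟩ := hnorm s l hl (by rw [mul_one] at hsl; rw [hsl, ← mul_assoc, hss, one_mul])
  let C := B'.comp (ψ.toLinearEquiv : L →ₗ[ℝ] L) (ψ.toLinearEquiv : L →ₗ[ℝ] L)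
  have hC : IsAdInvariantMetric C := hB'.pullback ψ
  have hCB : ∀ x y z : L, C ⁅x, y⁆ z = s * B ⁅x, y⁆ z := hψ
  let G : Submodule ℝ L := Submodule.span ℝ {m : L | ∃ x y : L, ⁅x, y⁆ = m}
  -- the lines among the summands span a complement `U` of the isotropic part of the center
  let T := {i : Fin k // ∃ p ∈ I i, (∀ x : L, ⁅p, x⁆ = 0) ∧ B p p ≠ 0}
  choose u huI huc huu using fun i : T => i.2
  have huline : ∀ i : T, ∀ x ∈ I i, ∃ a : ℝ, x = a • u i := fun i =>
    eq_smul_of_central hB (hI.irreducible i) (huI i) (huc i) (huu i)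
  have huo : ∀ i j : T, i ≠ j → B (u i) (u j) = 0 := fun i j hij =>
    ho i j (fun h => hij (Subtype.ext h)) _ (huI i) _ (huI j)
  have hli : LinearIndependent ℝ u :=
    LinearMap.BilinForm.linearIndependent_of_iIsOrtho (B := B) (fun i j hij => huo i j hij) huu
  let U : Submodule ℝ L := Submodule.span ℝ (Set.range u)
  let v : Module.Basis T ℝ U := Module.Basis.span hli
  have hv : ∀ i, (v i : L) = u i := fun i => congrArg Subtype.val (Module.Basis.span_apply hli i)
  have hUc : ∀ x ∈ U, ∀ y : L, ⁅x, y⁆ = 0 := by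
    intro x hx y
    induction hx using Submodule.span_induction with
    | mem x hx => obtain ⟨i, rfl⟩ := hx; exact huc i y
    | zero => simp
    | add x z _ _ hx hz => rw [add_lie, hx, hz, add_zero]
    | smul a x _ hx => rw [smul_lie, hx, smul_zero]
  have hUZ : ∀ x ∈ U, ∀ y z : L, B x ⁅y, z⁆ = 0 := fun x hx y z => by
    rw [← hB.lie_left, hUc x hx, map_zero, LinearMap.zero_apply]
  have hBU : (B.restrict U).Nondegenerate :=
    (LinearMap.BilinForm.iIsOrtho.nondegenerate_iff_not_isOrtho_basis_self (B.restrict U) v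
      (fun i j hij => by
        change B (v i) (v j) = 0
        rw [hv, hv, huo i j hij])).mpr fun i => by
        change B (v i) (v i) ≠ 0
        rw [hv]; exact huu i
  have hd : Disjoint U G := by
    rw [Submodule.disjoint_def]
    intro x hx hxG
    have : (⟨x, hx⟩ : U) = 0 := hBU.2 _ fun y => apply_derived_eq_zero (hUZ y y.2) x hxG
    exact congrArg Subtype.val this
  have hdec : ∀ z : L, (∀ x : L, ⁅z, x⁆ = 0) → ∃ u ∈ U, ∃ g ∈ G, z = u + g := by
    intro z hz
    obtain ⟨π, hmem, -, hsum, hlie, -⟩ := exists_projections hint ho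
    have hπc : ∀ i, ∀ x : L, ⁅π i z, x⁆ = 0 := fun i x => by
      rw [← lie_skew, ← hlie, ← lie_skew, hz, neg_zero, map_zero, neg_zero]
    have : z ∈ U ⊔ G := by
      rw [← hsum z]
      refine Submodule.sum_mem _ fun i _ => ?_
      by_cases hi : ∃ p ∈ I i, (∀ x : L, ⁅p, x⁆ = 0) ∧ B p p ≠ 0
      · obtain ⟨a, ha⟩ := huline ⟨i, hi⟩ _ (hmem i z)
        rw [ha]
        exact Submodule.mem_sup_left (U.smul_mem a (Submodule.subset_span ⟨_, rfl⟩))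
      · exact Submodule.mem_sup_right (mem_derived_of_central hB hint ho hi (hmem i z) (hπc i))
    obtain ⟨x, hx, g, hg, h⟩ := Submodule.mem_sup.mp this
    exact ⟨x, hx, g, hg, h.symm⟩
  have hCU : (C.restrict U).Nondegenerate := by
    refine restrict_nondegenerate_of_complement hC.isSymm hC.nondegenerate (G := G) ?_ hd ?_
    · intro x hx
      refine apply_derived_eq_zero fun y z => ?_
      rw [hC.symm, hCB, hB.symm, hUZ x hx, mul_zero]
    · intro z hz
      exact hdec z (hC.lie_eq_zero fun x y => hz _ (Submodule.subset_span ⟨x, y, rfl⟩))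
  have : Invertible (2 : ℝ) := invertibleOfNonzero two_ne_zero
  obtain ⟨w, hw⟩ := LinearMap.BilinForm.exists_orthogonal_basis (B := C.restrict U)
    ⟨fun x y => hC.symm _ _⟩
  have hwne : ∀ i, C (w i) (w i) ≠ 0 :=
    LinearMap.IsOrthoᵢ.not_isOrtho_basis_self_of_separatingLeft hw hCU.1
  -- Any bijection of the bases will do: signs on the lines are free, so signatures need not match.
  let σ := v.indexEquiv w
  choose e t he ht het using fun i : T => exists_sign_mul_sq (huu i) (hwne (σ i))
  -- the rescaled metric
  let ε : Fin k → ℝ := fun i =>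
    if h : ∃ p ∈ I i, (∀ x : L, ⁅p, x⁆ = 0) ∧ B p p ≠ 0 then e ⟨i, h⟩ else s
  have hεT : ∀ i : T, ε i = e i := fun i => dif_pos i.2
  have hεs : ∀ i, ε i = 1 ∨ ε i = -1 := fun i => by
    by_cases h : ∃ p ∈ I i, (∀ x : L, ⁅p, x⁆ = 0) ∧ B p p ≠ 0
    · rw [hεT ⟨i, h⟩]; exact he _
    · rw [show ε i = s from dif_neg h]; exact hs
  obtain ⟨E, hE⟩ := exists_scalar_on_summands hint ε
  have hEE : ∀ x, E (E x) = x := fun x => by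
    induction x using induction_on_summands hint with
    | h0 => simp
    | hadd x y hx hy => rw [map_add, map_add, hx, hy]
    | hmem i x hx =>
      rw [hE i x hx, map_smul, hE i x hx, smul_smul]
      rcases hεs i with h | h <;> rw [h] <;> norm_num
  have hEs := selfAdjoint_scalar_on_summands hint ho hE
  -- The lines are central, so brackets only involve the other summands, where `E` is `s`.
  have hEl : ∀ x y : L, E ⁅x, y⁆ = s • ⁅x, y⁆ := fun x y => by
    induction y using induction_on_summands hint with
    | h0 => simp
    | hadd y z hy hz => rw [lie_add, map_add, hy, hz, smul_add]
    | hmem i y hy =>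
      by_cases h : ∃ p ∈ I i, (∀ x : L, ⁅p, x⁆ = 0) ∧ B p p ≠ 0
      · obtain ⟨b, rfl⟩ := huline ⟨i, h⟩ y hy
        rw [← lie_skew, smul_lie, huc]
        simp
      · rw [hE i _ ((I i).lie_mem hy), show ε i = s from dif_neg h]
  let H : LinearMap.BilinForm ℝ L := B ∘ₗ E
  have hH : ∀ x y, H x y = B (E x) y := fun x y => rfl
  have hHs : H.IsSymm := ⟨fun x y => by rw [hH, hH, hEs, hB.symm]⟩
  have hHl : ∀ z x y : L, H z ⁅x, y⁆ = s * B z ⁅x, y⁆ := fun z x y => by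
    rw [hH, hEs, hEl, map_smul, smul_eq_mul]
  have hHsep : ∀ x, (∀ y, H x y = 0) → x = 0 := fun x hx => by
    rw [← hEE x, hB.eq_zero (x := E x) hx, map_zero]
  have hHn : H.Nondegenerate := ⟨hHsep, fun x hx => hHsep x fun y => by rw [hHs.eq, hx]⟩
  obtain ⟨η, hη⟩ := exists_isometry_of_orthogonal (C := H.restrict U) (C' := C.restrict U) v
    (fun i => w (σ i)) (fun i j hij => by
      change B (E (v i)) (v j) = 0
      rw [hv, hv, hE i _ (huI i), map_smul, LinearMap.smul_apply, huo i j hij, smul_zero])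
    (fun i j hij => hw (σ.injective.ne hij)) t (fun i => by
      change t i ^ 2 * C (w (σ i)) (w (σ i)) = B (E (v i)) (v i)
      rw [hv, hE i _ (huI i), map_smul, LinearMap.smul_apply, smul_eq_mul, het, hεT])
  obtain ⟨χ, hχ⟩ := exists_lieEquiv_of_agree hHs hHn hC.isSymm hC.nondegenerate
    (fun x y z => by rw [hHs.eq, hHl, hCB, hB.symm])
    (fun z hz => hB.lie_eq_zero fun x y =>
      (mul_eq_zero.mp ((hHl z x y).symm.trans (hz x y))).resolve_left hs0)
    (fun x hx y z => by rw [hHl, hUZ x hx, mul_zero]) hd hdec η hη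
  refine ⟨ψ.symm.trans χ, ε, H, hεs, ⟨fun i j hij x hx y hy => ?_, fun i x hx y _ => ?_⟩,
    fun x y => ?_⟩
  · rw [hH, hE i x hx, map_smul, LinearMap.smul_apply, ho i j hij x hx y hy, smul_zero]
  · rw [hH, hE i x hx, map_smul, LinearMap.smul_apply, smul_eq_mul]
  · rw [LieEquiv.trans_apply, LieEquiv.trans_apply, ← hχ]
    change _ = B' (ψ _) (ψ _)
    rw [ψ.apply_symm_apply, ψ.apply_symm_apply]

end Real

/-! ### Irreducible algebras as one-summand decompositions -/

section Irreducible

variable {K L : Type*} [Field K] [LieRing L] [LieAlgebra K L]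

theorem isIrreducibleLie_top (h : IsIrreducibleLie K L) :
    IsIrreducibleLie K (⊤ : LieIdeal K L) := by
  intro I J hIJ
  let f : LieIdeal K (⊤ : LieIdeal K L) → LieIdeal K L := fun I =>
    { I.toSubmodule.comap (Submodule.topEquiv (R := K) (M := L)).symm.toLinearMap with
      lie_mem := fun {x m} hm => I.lie_mem (x := ⟨x, LieSubmodule.mem_top x⟩) hm }
  have hf : ∀ (I : LieIdeal K (⊤ : LieIdeal K L)) (x : (⊤ : LieIdeal K L)),
      (x : L) ∈ f I ↔ x ∈ I := fun I x => Iff.rfl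
  have hbot : ∀ I, f I = ⊥ → I = ⊥ := fun I hI => by
    rw [LieSubmodule.eq_bot_iff]
    intro x hx
    rw [← hf, hI, LieSubmodule.mem_bot] at hx
    exact Subtype.ext hx
  have hcompl : IsCompl (f I) (f J) := by
    constructor
    · rw [disjoint_iff, LieSubmodule.eq_bot_iff]
      intro x hx
      obtain ⟨h1, h2⟩ := LieSubmodule.mem_inf _ _ _ |>.mp hx
      have h3 : (⟨x, LieSubmodule.mem_top x⟩ : (⊤ : LieIdeal K L)) ∈ I ⊓ J :=
        (LieSubmodule.mem_inf _ _ _).mpr ⟨h1, h2⟩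
      rw [hIJ.inf_eq_bot, LieSubmodule.mem_bot] at h3
      exact congrArg Subtype.val h3
    · rw [codisjoint_iff, eq_top_iff]
      intro x _
      have h3 : (⟨x, LieSubmodule.mem_top x⟩ : (⊤ : LieIdeal K L)) ∈ I ⊔ J := by
        rw [hIJ.sup_eq_top]; exact LieSubmodule.mem_top _
      obtain ⟨y, hy, z, hz, hyz⟩ := (LieSubmodule.mem_sup _ _ _).mp h3
      exact (LieSubmodule.mem_sup _ _ _).mpr ⟨y, hy, z, hz, congrArg Subtype.val hyz⟩
  exact (h _ _ hcompl).imp (hbot I) (hbot J)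

theorem isOrthogonalIrreducibleDecomposition_top (B : LinearMap.BilinForm K L)
    (h : IsIrreducibleLie K L) :
    IsOrthogonalIrreducibleDecomposition B fun _ : Fin 1 => (⊤ : LieIdeal K L) := by
  refine ⟨?_, fun i j hij => absurd (Subsingleton.elim i j) hij, fun _ => isIrreducibleLie_top h⟩
  refine DirectSum.isInternal_submodule_of_iSupIndep_of_iSup_eq_top ?_ ?_
  · intro i
    rw [disjoint_iff, eq_bot_iff]
    refine inf_le_right.trans ?_
    simp [Subsingleton.elim _ i]
  · rw [ciSup_const]
    rfl

end Irreducible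

end SolitaryLie

theorem mainTheorem6 :
    (∀ (L : Type*) [LieRing L] [LieAlgebra ℝ L] [FiniteDimensional ℝ L],
      LieAlgebra.IsSolvable L → Module.finrank ℝ L ≤ 6 →
        SolitaryLie.IsTStarSolitary ℝ L ∧
        ∀ B : LinearMap.BilinForm ℝ L, SolitaryLie.IsAdInvariantMetric B →
          SolitaryLie.IsSolitary B ∧
          (SolitaryLie.IsIrreducibleLie ℝ L →
            ∀ B' : LinearMap.BilinForm ℝ L, SolitaryLie.IsAdInvariantMetric B' →
              ∃ ψ : L ≃ₗ⁅ℝ⁆ L,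
                (∀ x y : L, B' x y = B (ψ x) (ψ y)) ∨ (∀ x y : L, B' x y = -B (ψ x) (ψ y))) ∧
          (∀ (k : ℕ) (I : Fin k → LieIdeal ℝ L),
            SolitaryLie.IsOrthogonalIrreducibleDecomposition B I →
            ∀ B' : LinearMap.BilinForm ℝ L, SolitaryLie.IsAdInvariantMetric B' →
              ∃ (ψ : L ≃ₗ⁅ℝ⁆ L) (ε : Fin k → ℝ) (h : LinearMap.BilinForm ℝ L),
                (∀ i, ε i = 1 ∨ ε i = -1) ∧ SolitaryLie.IsRescalingAlong B I ε h ∧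
                ∀ x y : L, B' x y = h (ψ x) (ψ y))) ∧
    (∀ (L : Type*) [LieRing L] [LieAlgebra ℂ L] [FiniteDimensional ℂ L],
      LieAlgebra.IsSolvable L → Module.finrank ℂ L ≤ 6 →
        SolitaryLie.IsTStarSolitary ℂ L ∧
        ∀ B : LinearMap.BilinForm ℂ L, SolitaryLie.IsAdInvariantMetric B →
          SolitaryLie.IsSolitary B ∧
          ∀ B' : LinearMap.BilinForm ℂ L, SolitaryLie.IsAdInvariantMetric B' →
            ∃ ψ : L ≃ₗ⁅ℂ⁆ L, ∀ x y : L, B' x y = B (ψ x) (ψ y)) := by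
  refine ⟨fun L _ _ _ hsol hdim => ?_, fun L _ _ _ hsol hdim => ?_⟩
  · have hT := SolitaryLie.isTStarSolitary_of_finrank_le (K := ℝ) (L := L) hdim
    refine ⟨hT, fun B hB => ⟨hT.isSolitary hB, fun hirr B' hB' => ?_,
      fun k I hI B' hB' => SolitaryLie.exists_lieEquiv_real hdim hB hI hB'⟩⟩
    obtain ⟨ψ, ε, h, hε, ⟨-, hh⟩, hψ⟩ := SolitaryLie.exists_lieEquiv_real hdim hB
      (SolitaryLie.isOrthogonalIrreducibleDecomposition_top B hirr) hB'
    refine ⟨ψ, (hε 0).imp (fun h0 x y => ?_) fun h0 x y => ?_⟩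
    · rw [hψ, hh 0 _ (LieSubmodule.mem_top _) _ (LieSubmodule.mem_top _), h0, one_mul]
    · rw [hψ, hh 0 _ (LieSubmodule.mem_top _) _ (LieSubmodule.mem_top _), h0, neg_one_mul]
  · have hT := SolitaryLie.isTStarSolitary_of_finrank_le (K := ℂ) (L := L) hdim
    exact ⟨hT, fun B hB => ⟨hT.isSolitary hB, fun B' hB' =>
      SolitaryLie.exists_lieEquiv_complex hdim hB hB'⟩⟩
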